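/- Fix an algebraic closure $\overline{\mathbb Q}$ of $\mathbb Q$, and let $K\subset\overline{\mathbb Q}$ be a quadratic field. Let $E$ be an elliptic curve over $K$ without complex multiplication, i.e. all $\overline{\mathbb Q}$-endomorphisms of $E$ are multiplications by integers. For $\sigma\in G=\mathrm{Gal}(K/\mathbb Q)$ write ${}^{\sigma}E$ for the conjugate curve. Assume that $E$ is a $\mathbb Q$-curve, i.e. for every $\sigma\in G$ there is a $\overline{\mathbb Q}$-isogeny ${}^{\sigma}E\to E$, and that $E$ is not completely defined over $K$, i.e. not all $\overline{\mathbb Q}$-isogenies between the conjugates ${}^{\sigma}E$ $(\sigma\in G)$ are defined over $K$. Choose any $\overline{\mathbb Q}$-isogenies $\mu_\sigma\colon {}^{\sigma}E\to E$ $(\sigma\in G)$, and let $\lambda_\sigma\in\overline{\mathbb Q}^\times$ be the factor such that, when $E$ is given by an equation $y^2=x^3+Ax+B$, $$\mu_\sigma(x,y)=\Bigl(F_\sigma(x),\ \tfrac{1}{\lambda_\sigma}\,y\,F_\sigma'(x)\Bigr)$$ for a rational function $F_\sigma$. (For a general Weierstrass equation replace $y$, on the source and on the target, by $y+\tfrac12(a_1x+a_3)$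 with the coefficients of the respective curve; equivalently, $\mu_\sigma$ pulls the invariant differential $\frac{dx}{2y+a_1x+a_3}$ of $E$ back to $\lambda_\sigma$ times that of ${}^{\sigma}E$.) Let $L=K(\lambda_\sigma:\sigma\in G)$ be the minimal field of complete definition of $E$. Then $L/\mathbb Q$ is Galois and $\mathrm{Gal}(L/\mathbb Q)\cong C_2\times C_2$ (so this group is not $C_4$). -/

import Mathlib

/-! # `ℚ`-curves, isogenies and the minimal field of complete definition -/

open WeierstrassCurve

namespace QCurve

/-- A fixed algebraic closure of `ℚ`; all fields below are subfields of it. -/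
abbrev Qbar : Type := AlgebraicClosure ℚ

noncomputable instance decidableEqQbar : DecidableEq Qbar := Classical.decEq _

section Maps

variable {F : Type*} [Field F] [DecidableEq F]

/-- A homomorphism `φ : W₁(F) → W₂(F)` is *given by rational functions with coefficients in `k`*:
there are polynomials `p, q, r, s ∈ k[x, y]` such that
`φ(x, y) = (p(x, y) / q(x, y), r(x, y) / s(x, y))`, with non-vanishing denominators, for all but
finitely many points `(x, y)` of `W₁(F)`. (In particular `φ` is not the zero map when `W₁(F)` is
infinite.) -/
def IsRationalOver (k : Type*) [Field k] [Algebra k F] {W₁ W₂ : WeierstrassCurve F}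
    (φ : W₁.toAffine.Point →+ W₂.toAffine.Point) : Prop :=
  ∃ p q r s : MvPolynomial (Fin 2) k, ∀ᶠ P : W₁.toAffine.Point in Filter.cofinite,
    ∃ (x y : F) (h : W₁.toAffine.Nonsingular x y) (x' y' : F)
      (h' : W₂.toAffine.Nonsingular x' y'),
      P = Affine.Point.some x y h ∧ φ P = Affine.Point.some x' y' h' ∧
      MvPolynomial.aeval ![x, y] q ≠ 0 ∧ MvPolynomial.aeval ![x, y] s ≠ 0 ∧
      x' = MvPolynomial.aeval ![x, y] p / MvPolynomial.aeval ![x, y] q ∧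
      y' = MvPolynomial.aeval ![x, y] r / MvPolynomial.aeval ![x, y] s

/-- An isogeny between elliptic curves over an algebraically closed field `F`: a non-constant
homomorphism on `F`-points that is given by rational functions over `F`. (Non-constancy is
contained in `IsRationalOver`, because the rational functions take values in the affine part.) -/
structure Isogeny (W₁ W₂ : WeierstrassCurve F) where
  /-- The homomorphism on points. -/
  toHom : W₁.toAffine.Point →+ W₂.toAffine.Point
  /-- It is given by rational functions. -/
  rational : IsRationalOver F toHom

/-- The isogeny `φ` is defined over the field `k`. -/
def Isogeny.IsDefinedOver (k : Type*) [Field k] [Algebra k F] {W₁ W₂ : WeierstrassCurve F}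
    (φ : Isogeny W₁ W₂) : Prop :=
  IsRationalOver k φ.toHom

/-- `l ≠ 0` is the factor `λ` in the standard form of the isogeny `φ`. When `W₁` and `W₂` are given
by short equations `y² = x³ + A x + B`, it says
`φ(x, y) = (f(x), (1 / λ) * y * f'(x))` for a rational function `f = p / q`, at all but finitely
many points. For general Weierstrass equations (in characteristic `≠ 2`), `y` is replaced on both
sides by `y + (a₁ x + a₃) / 2`; in all cases `λ` is the factor by which `φ` multiplies the invariant
differential `dx / (2 y + a₁ x + a₃)` under pull-back. -/
def Isogeny.HasFactor {W₁ W₂ : WeierstrassCurve F} (φ : Isogeny W₁ W₂) (l : F) : Prop :=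
  l ≠ 0 ∧ ∃ p q : Polynomial F, ∀ᶠ P : W₁.toAffine.Point in Filter.cofinite,
    ∃ (x y : F) (h : W₁.toAffine.Nonsingular x y) (x' y' : F)
      (h' : W₂.toAffine.Nonsingular x' y'),
      P = Affine.Point.some x y h ∧ φ.toHom P = Affine.Point.some x' y' h' ∧
      q.eval x ≠ 0 ∧
      x' = p.eval x / q.eval x ∧
      2 * y' + W₂.a₁ * x' + W₂.a₃ =
        1 / l * (2 * y + W₁.a₁ * x + W₁.a₃) *
          ((p.derivative * q - p * q.derivative).eval x / q.eval x ^ 2)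

/-- An elliptic curve over an algebraically closed field of characteristic `0` has complex
multiplication if it has an endomorphism other than the multiplications by integers. -/
def HasCM (W : WeierstrassCurve F) : Prop :=
  ∃ φ : Isogeny W W, ∀ n : ℤ, ∃ P : W.toAffine.Point, φ.toHom P ≠ n • P

end Maps

section Curves

variable {K : IntermediateField ℚ Qbar}

/-- The conjugate curve `^σE`: apply `σ` to the coefficients of `E`. -/
noncomputable def conj (σ : Gal(K/ℚ)) (E : WeierstrassCurve K) : WeierstrassCurve K :=
  E.map (σ : K →+* K)

/-- The curve `E` regarded over `Qbar`. -/
noncomputable def geom (E : WeierstrassCurve K) : WeierstrassCurve Qbar :=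
  E.baseChange Qbar

/-- `E` (an elliptic curve over a Galois extension `K` of `ℚ`) is a `ℚ`-curve: every conjugate of
`E` is isogenous to `E` over `Qbar`. -/
def IsQCurve (E : WeierstrassCurve K) : Prop :=
  ∀ σ : Gal(K/ℚ), Nonempty (Isogeny (geom (conj σ E)) (geom E))

/-- The `ℚ`-curve `E` is completely defined over `K`: all `Qbar`-isogenies between the conjugates
of `E` are defined over `K`. -/
def IsCompletelyDefined (E : WeierstrassCurve K) : Prop :=
  IsQCurve E ∧ ∀ (σ τ : Gal(K/ℚ)) (φ : Isogeny (geom (conj σ E)) (geom (conj τ E))),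
    φ.IsDefinedOver K

/-- The minimal field of complete definition `K(λ_σ : σ ∈ Gal(K/ℚ))` of a `ℚ`-curve `E` without CM,
computed from a system of isogenies `μ_σ : ^σE → E`; here `λ_σ` is the factor of `μ_σ`. -/
noncomputable def minimalField (E : WeierstrassCurve K)
    (μ : ∀ σ : Gal(K/ℚ), Isogeny (geom (conj σ E)) (geom E)) : IntermediateField ℚ Qbar :=
  K ⊔ IntermediateField.adjoin ℚ {l : Qbar | ∃ σ : Gal(K/ℚ), (μ σ).HasFactor l}

end Curves

end QCurve

namespace QCurve

/-! ### The derivation of F(X) and invariants of a substitution -/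

section RationalFunctions

open Polynomial

variable {F : Type*} [Field F]

/-! The theorem follows from three properties of the factor λ of an isogeny: it is multiplicative
under composition, it is carried to τ(λ) when the isogeny is conjugated by τ, and it determines the
isogeny once source and target are fixed.

Without CM an endomorphism is some [n], and so is each of its conjugates. Hence both commute with
any isogeny from the conjugate curve to E, and comparing factors shows that the factor of the
endomorphism is fixed by Galois, so rational (`exists_rat_of_endomorphism`). Now let σ be the
nontrivial element of Gal(K/ℚ) and λ the factor of μ_σ. If τ is trivial on K, then μ_σ and its
τ-conjugate have the same source and target and differ by a rational factor: τ(λ) = rλ. As λ has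
finitely many conjugates, r = ±1. If τ is nontrivial on K, then μ_σ composed with its τ-conjugate is
an endomorphism of E, so λ·τ(λ) is rational.

If λ were in K, every isogeny between conjugates of E would have a factor in K, would equal its
conjugates over K, and would be defined over K by descent (`isCompletelyDefined_of_factor_mem`). So
λ ∉ K, while λ² ∈ K; thus L = K(λ) has degree 4. It is normal, and every τ squares to the identity
on K and on λ: from λ·τ(λ) = r one gets τ(τ(λ)) = λ. A group of order 4 and exponent 2 is the Klein
group (`isGalois_and_isKleinFour`).

The geometric input is proved by hand. With η = 2y + a₁x + a₃, a homomorphism given by rational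
functions has the form x ↦ f(x), η ↦ η·g(x), and the factor is f'/g. It is constant because φ
commutes with [2], which makes f'/g invariant under x ↦ x([2]P), and such an invariant is constant
(`exists_C_of_invariant`). Two maps with equal factor have a difference with constant x-coordinate,
by the addition law, so they coincide (`HasForm.eq_of_ratDeriv_eq`). -/

theorem fst_algebraMap_dualNumber (r : RatFunc F) :
    TrivSqZeroExt.fst (algebraMap (RatFunc F) (DualNumber (RatFunc F)) r) = r := rfl

/-- The ring homomorphism `F[X] → F(X)[ε]`, `p ↦ p + p' ε`. -/
noncomputable def polyTaylor : F[X] →+* DualNumber (RatFunc F) where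
  toFun p := TrivSqZeroExt.inl (algebraMap F[X] (RatFunc F) p) +
      TrivSqZeroExt.inr (algebraMap F[X] (RatFunc F) (derivative p))
  map_one' := by ext <;> simp
  map_zero' := by ext <;> simp
  map_add' p q := by ext <;> simp [Algebra.smul_def]
  map_mul' p q := by ext <;> simp [Algebra.smul_def, fst_algebraMap_dualNumber]; ring

/-- The ring homomorphism `F(X) → F(X)[ε]`, `r ↦ r + r' ε`. -/
noncomputable def ratFuncTaylor : RatFunc F →+* DualNumber (RatFunc F) :=
  IsLocalization.lift (M := nonZeroDivisors F[X]) (S := RatFunc F) (g := polyTaylor)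
    (fun p => by
      rw [TrivSqZeroExt.isUnit_iff_isUnit_fst, isUnit_iff_ne_zero]
      simp [polyTaylor])

theorem ratFuncTaylor_algebraMap (p : F[X]) :
    ratFuncTaylor (algebraMap F[X] (RatFunc F) p) = polyTaylor p :=
  IsLocalization.lift_eq _ _

theorem RatFunc.ringHom_ext {R : Type*} [Semiring R] {f g : RatFunc F →+* R}
    (hC : ∀ a, f (RatFunc.C a) = g (RatFunc.C a)) (hX : f RatFunc.X = g RatFunc.X) : f = g := by
  refine IsLocalization.ringHom_ext (nonZeroDivisors F[X]) (Polynomial.ringHom_ext ?_ ?_)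
  · intro a; simpa using hC a
  · simpa using hX

theorem fst_ratFuncTaylor (r : RatFunc F) : (ratFuncTaylor r).fst = r := by
  have : ((TrivSqZeroExt.fstHom F (RatFunc F) (RatFunc F) :
      DualNumber (RatFunc F) →+* RatFunc F)).comp ratFuncTaylor = RingHom.id _ := by
    apply RatFunc.ringHom_ext
    · intro a
      simp [← RatFunc.algebraMap_C, ratFuncTaylor_algebraMap, polyTaylor]
    · simp [← RatFunc.algebraMap_X, ratFuncTaylor_algebraMap, polyTaylor]
  exact congrArg (fun f => f r) this

/-- The derivation `d/dX` of the field `F(X)`. -/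
noncomputable def ratDeriv : Derivation F (RatFunc F) (RatFunc F) where
  toFun r := (ratFuncTaylor r).snd
  map_add' r s := by simp
  map_smul' a r := by
    rw [RatFunc.smul_eq_C_mul, map_mul, ← RatFunc.algebraMap_C, ratFuncTaylor_algebraMap]
    simp [polyTaylor, RatFunc.smul_eq_C_mul]
  map_one_eq_zero' := by simp
  leibniz' r s := by simp [fst_ratFuncTaylor, mul_comm]

theorem ratDeriv_algebraMap (p : F[X]) :
    ratDeriv (algebraMap F[X] (RatFunc F) p) = algebraMap F[X] (RatFunc F) (derivative p) := by
  change (ratFuncTaylor _).snd = _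
  simp [ratFuncTaylor_algebraMap, polyTaylor, Algebra.smul_def, fst_algebraMap_dualNumber]

@[simp]
theorem ratDeriv_C (a : F) : ratDeriv (RatFunc.C a : RatFunc F) = 0 := by
  simp [← RatFunc.algebraMap_C, ratDeriv_algebraMap]

theorem ratDeriv_div (p q : F[X]) :
    ratDeriv (algebraMap F[X] (RatFunc F) p / algebraMap F[X] (RatFunc F) q) =
      algebraMap F[X] (RatFunc F) (derivative p * q - p * derivative q) /
        algebraMap F[X] (RatFunc F) q ^ 2 := by
  rw [Derivation.leibniz_div, ratDeriv_algebraMap, ratDeriv_algebraMap]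
  simp only [smul_eq_mul, map_sub, map_mul]
  ring

theorem ratAlgHom_C (s : RatFunc F →ₐ[F] RatFunc F) (a : F) :
    s (RatFunc.C a) = RatFunc.C a := by
  rw [← RatFunc.algebraMap_eq_C, AlgHom.commutes]

/-- The chain rule for substitution. -/
theorem ratDeriv_algHom (s : RatFunc F →ₐ[F] RatFunc F) (r : RatFunc F) :
    ratDeriv (s r) = s (ratDeriv r) * ratDeriv (s RatFunc.X) := by
  have key (p : F[X]) : ratDeriv (s (algebraMap F[X] (RatFunc F) p)) =
      s (algebraMap F[X] (RatFunc F) (derivative p)) * ratDeriv (s RatFunc.X) := by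
    have h (p : F[X]) : s (algebraMap F[X] (RatFunc F) p) = aeval (s RatFunc.X) p := by
      rw [Polynomial.aeval_algHom_apply, RatFunc.aeval_X_left_eq_algebraMap]
    rw [h, h, Derivation.map_aeval, smul_eq_mul]
  induction r using RatFunc.induction_on with
  | f p q hq =>
    have hq' : algebraMap F[X] (RatFunc F) q ≠ 0 := RatFunc.algebraMap_ne_zero hq
    have hsq : s (algebraMap F[X] (RatFunc F) q) ≠ 0 := (map_ne_zero s).mpr hq'
    rw [map_div₀, Derivation.leibniz_div, key, key, ratDeriv_div]
    simp only [smul_eq_mul, map_sub, map_mul, map_div₀, map_pow]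
    field_simp

/-- In lowest terms p/q, a zero derivative means p'q = pq'. Coprimality gives q ∣ q', so q' = 0 by
degree, and then p' = 0. -/
theorem exists_C_of_ratDeriv_eq_zero [CharZero F] {r : RatFunc F} (h : ratDeriv r = 0) :
    ∃ a, r = RatFunc.C a := by
  have hq : algebraMap F[X] (RatFunc F) r.denom ≠ 0 := RatFunc.algebraMap_ne_zero r.denom_ne_zero
  rw [← r.num_div_denom, ratDeriv_div, div_eq_zero_iff, or_iff_left (pow_ne_zero 2 hq),
    ← map_zero (algebraMap F[X] (RatFunc F)), (RatFunc.algebraMap_injective F).eq_iff,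
    sub_eq_zero] at h
  have hcop := r.isCoprime_num_denom
  have hdvd : r.denom ∣ derivative r.denom :=
    hcop.symm.dvd_of_dvd_mul_left (Dvd.intro_left _ h)
  have hd : derivative r.denom = 0 := by
    by_contra h0
    exact (Polynomial.degree_derivative_lt r.denom_ne_zero).not_ge (degree_le_of_dvd hdvd h0)
  rw [hd, mul_zero, mul_eq_zero, or_iff_left r.denom_ne_zero] at h
  obtain ⟨a, ha⟩ := natDegree_eq_zero.mp (derivative_eq_zero.mp h)
  obtain ⟨b, hb⟩ := natDegree_eq_zero.mp (derivative_eq_zero.mp hd)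
  refine ⟨a / b, ?_⟩
  rw [← r.num_div_denom, ← ha, ← hb]
  simp

/-- The numerator of `p(a / b)` over the denominator `b ^ deg p`. -/
theorem exists_homogenization {a b : F[X]} (hb : b ≠ 0) (ha : a.Monic)
    (hab : b.natDegree < a.natDegree) (p : F[X]) :
    ∃ N : F[X], aeval (algebraMap F[X] (RatFunc F) a / algebraMap F[X] (RatFunc F) b) p *
      algebraMap F[X] (RatFunc F) b ^ p.natDegree = algebraMap F[X] (RatFunc F) N ∧
      N.leadingCoeff = p.leadingCoeff := by
  have hb' : algebraMap F[X] (RatFunc F) b ≠ 0 := RatFunc.algebraMap_ne_zero hb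
  set n := p.natDegree with hn
  set N : F[X] := ∑ i ∈ Finset.range (n + 1), C (p.coeff i) * a ^ i * b ^ (n - i) with hN
  refine ⟨N, ?_, ?_⟩
  · rw [aeval_eq_sum_range, ← hn, Finset.sum_mul, hN, map_sum]
    refine Finset.sum_congr rfl fun i hi => ?_
    have hi' : i ≤ n := by simpa [Nat.lt_succ_iff] using hi
    simp only [map_mul, map_pow, RatFunc.algebraMap_C, RatFunc.smul_eq_C_mul]
    obtain ⟨k, hk⟩ := Nat.exists_eq_add_of_le hi'
    rw [hk, Nat.add_sub_cancel_left, div_pow, pow_add]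
    field_simp
  · have hdeg (i : ℕ) (hi : i ∈ Finset.range n) :
        (C (p.coeff i) * a ^ i * b ^ (n - i)).degree < ((n * a.natDegree : ℕ) : WithBot ℕ) := by
      have hi' : i < n := by simpa using hi
      obtain ⟨k, hk⟩ := Nat.exists_eq_add_of_lt hi'
      rw [hk]
      refine degree_le_natDegree.trans_lt (Nat.cast_lt.mpr ?_)
      have h1 : (C (p.coeff i) * a ^ i * b ^ (i + k + 1 - i)).natDegree ≤
          i * a.natDegree + (k + 1) * b.natDegree := by
        refine natDegree_mul_le.trans (add_le_add ((natDegree_C_mul_le _ _).trans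
          natDegree_pow_le) ?_)
        rw [show i + k + 1 - i = k + 1 by omega]
        exact natDegree_pow_le
      refine h1.trans_lt ?_
      nlinarith
    by_cases hp : p = 0
    · simp [hN, hp]
    have hlast : (C (p.coeff n) * a ^ n).degree = ((n * a.natDegree : ℕ) : WithBot ℕ) := by
      have h0 : p.coeff n ≠ 0 := by simpa [hn] using hp
      rw [degree_mul, degree_C h0, zero_add, degree_eq_natDegree (ha.pow n).ne_zero, ha.natDegree_pow]
    rw [hN, Finset.sum_range_succ, Nat.sub_self, pow_zero, mul_one,
      leadingCoeff_add_of_degree_lt, leadingCoeff_mul, leadingCoeff_C, (ha.pow n).leadingCoeff,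
      mul_one, hn, coeff_natDegree]
    rw [hlast]
    exact (degree_sum_le _ _).trans_lt ((Finset.sup_lt_iff (WithBot.bot_lt_coe _)).mpr hdeg)

/-- A rational function invariant under `X ↦ a / b`, where `deg b < deg a` and the ratio of the
leading coefficients is not a root of unity, is constant. -/
theorem exists_C_of_invariant {a b : F[X]} (hb : b ≠ 0) (ha : a.Monic)
    (hab : b.natDegree < a.natDegree)
    (hlc : Function.Injective fun n : ℕ => b.leadingCoeff ^ n)
    (s : RatFunc F →ₐ[F] RatFunc F)
    (hs : s RatFunc.X = algebraMap F[X] (RatFunc F) a / algebraMap F[X] (RatFunc F) b)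
    {r : RatFunc F} (hr : s r = r) : ∃ c, r = RatFunc.C c := by
  have hb' : algebraMap F[X] (RatFunc F) b ≠ 0 := RatFunc.algebraMap_ne_zero hb
  -- Clear denominators in p(a/b)·q = p·q(a/b) and compare leading coefficients: lc(b)^(deg q) =
  -- lc(b)^(deg p), hence equal degrees.
  have key (p q : F[X]) (hp : p ≠ 0) (hq : q ≠ 0)
      (h : s (algebraMap F[X] (RatFunc F) p / algebraMap F[X] (RatFunc F) q) =
        algebraMap F[X] (RatFunc F) p / algebraMap F[X] (RatFunc F) q) :
      p.natDegree = q.natDegree := by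
    have hs' (p : F[X]) : s (algebraMap F[X] (RatFunc F) p) = aeval (s RatFunc.X) p := by
      rw [Polynomial.aeval_algHom_apply, RatFunc.aeval_X_left_eq_algebraMap]
    have hq' : algebraMap F[X] (RatFunc F) q ≠ 0 := RatFunc.algebraMap_ne_zero hq
    have hsq : s (algebraMap F[X] (RatFunc F) q) ≠ 0 := (map_ne_zero s).mpr hq'
    obtain ⟨N, hN, hNl⟩ := exists_homogenization hb ha hab p
    obtain ⟨M, hM, hMl⟩ := exists_homogenization hb ha hab q
    rw [← hs, ← hs'] at hN hM
    rw [map_div₀, div_eq_div_iff hsq hq'] at h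
    have h2 : N * b ^ q.natDegree * q = p * M * b ^ p.natDegree := by
      apply RatFunc.algebraMap_injective F
      simp only [map_mul, map_pow]
      rw [← hN, ← hM]
      linear_combination (algebraMap F[X] (RatFunc F) b ^ p.natDegree) *
        (algebraMap F[X] (RatFunc F) b ^ q.natDegree) * h
    have h3 := congrArg leadingCoeff h2
    simp only [leadingCoeff_mul, leadingCoeff_pow, hNl, hMl] at h3
    have hpl : p.leadingCoeff ≠ 0 := leadingCoeff_ne_zero.mpr hp
    have hql : q.leadingCoeff ≠ 0 := leadingCoeff_ne_zero.mpr hq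
    apply hlc
    apply mul_left_cancel₀ (mul_ne_zero hpl hql)
    simp only
    linear_combination -h3
  by_cases h0 : r = 0
  · exact ⟨0, by simp [h0]⟩
  have hd := key r.num r.denom (RatFunc.num_ne_zero h0) r.denom_ne_zero
    (by rw [r.num_div_denom, hr])
  refine ⟨r.num.leadingCoeff, ?_⟩
  have hq' : algebraMap F[X] (RatFunc F) r.denom ≠ 0 := RatFunc.algebraMap_ne_zero r.denom_ne_zero
  -- Subtract the value of r at infinity. The difference is again invariant, but its numerator has
  -- smaller degree than its denominator, so `key` forces it to vanish.
  set p₁ := r.num - C r.num.leadingCoeff * r.denom with hp₁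
  have hrp : r - RatFunc.C r.num.leadingCoeff =
      algebraMap F[X] (RatFunc F) p₁ / algebraMap F[X] (RatFunc F) r.denom := by
    nth_rewrite 1 [← r.num_div_denom]
    rw [hp₁, map_sub, map_mul, RatFunc.algebraMap_C]
    field_simp
  rw [← sub_eq_zero, hrp, div_eq_zero_iff, or_iff_left hq']
  by_contra hne
  have hne' : p₁ ≠ 0 := fun h => hne (by simp [h])
  have hdeg := key p₁ r.denom hne' r.denom_ne_zero (by
    rw [← hrp, map_sub, hr, ratAlgHom_C])
  have hlt : p₁.degree < r.num.degree := by
    have hl : r.num.leadingCoeff ≠ 0 := leadingCoeff_ne_zero.mpr (RatFunc.num_ne_zero h0)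
    refine degree_sub_lt_left ?_ (RatFunc.num_ne_zero h0) ?_
    · rw [degree_C_mul hl, degree_eq_natDegree r.denom_ne_zero,
        degree_eq_natDegree (RatFunc.num_ne_zero h0), hd]
    · rw [leadingCoeff_mul, leadingCoeff_C, r.monic_denom.leadingCoeff, mul_one]
  have := natDegree_lt_natDegree hne' hlt
  omega

/-- Substitution of a transcendental rational function. -/
noncomputable def ratSubst (f : RatFunc F) (hf : Transcendental F f) :
    RatFunc F →ₐ[F] RatFunc F :=
  IsLocalization.liftAlgHom (M := nonZeroDivisors F[X]) (S := RatFunc F) (f := aeval f)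
    (fun p => by
      rw [isUnit_iff_ne_zero]
      exact fun h => nonZeroDivisors.ne_zero p.2 (transcendental_iff.mp hf _ h))

theorem ratSubst_X (f : RatFunc F) (hf : Transcendental F f) : ratSubst f hf RatFunc.X = f := by
  rw [← RatFunc.algebraMap_X, ratSubst, IsLocalization.liftAlgHom_apply, IsLocalization.lift_eq]
  simp

end RationalFunctions

/-! ### The coordinates x and η on points, doubling and subtraction -/

section Coordinates

open Polynomial Filter

variable {F : Type*} [Field F] {W : WeierstrassCurve F}

/-- The `x`-coordinate of a point, with value `0` at the point at infinity. -/
def xCoord : W.toAffine.Point → F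
  | .zero => 0
  | .some x _ _ => x

/-- The `y`-coordinate of a point, with value `0` at the point at infinity. -/
def yCoord : W.toAffine.Point → F
  | .zero => 0
  | .some _ y _ => y

/-- The function `η = 2 y + a₁ x + a₃`. -/
def etaCoord (P : W.toAffine.Point) : F := 2 * yCoord P + W.a₁ * xCoord P + W.a₃

@[simp]
theorem xCoord_some {x y : F} (h : W.toAffine.Nonsingular x y) :
    xCoord (Affine.Point.some x y h) = x := rfl

@[simp]
theorem yCoord_some {x y : F} (h : W.toAffine.Nonsingular x y) :
    yCoord (Affine.Point.some x y h) = y := rfl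

theorem etaCoord_some {x y : F} (h : W.toAffine.Nonsingular x y) :
    etaCoord (Affine.Point.some x y h) = 2 * y + W.a₁ * x + W.a₃ := rfl

theorem exists_some_of_ne_zero {P : W.toAffine.Point} (hP : P ≠ 0) :
    ∃ (x y : F) (h : W.toAffine.Nonsingular x y), P = Affine.Point.some x y h := by
  cases P with
  | zero => exact absurd rfl hP
  | some x y h => exact ⟨x, y, h, rfl⟩

theorem xCoord_neg (P : W.toAffine.Point) : xCoord (-P) = xCoord P := by
  cases P <;> rfl

theorem etaCoord_neg {P : W.toAffine.Point} (hP : P ≠ 0) : etaCoord (-P) = -etaCoord P := by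
  obtain ⟨x, y, h, rfl⟩ := exists_some_of_ne_zero hP
  rw [Affine.Point.neg_some, etaCoord_some, etaCoord_some, Affine.negY]
  ring

theorem yCoord_sub_yCoord_neg {P : W.toAffine.Point} (hP : P ≠ 0) :
    yCoord P - yCoord (-P) = etaCoord P := by
  obtain ⟨x, y, h, rfl⟩ := exists_some_of_ne_zero hP
  rw [Affine.Point.neg_some, etaCoord_some, yCoord_some, yCoord_some, Affine.negY]
  ring

theorem etaCoord_sq {P : W.toAffine.Point} (hP : P ≠ 0) :
    etaCoord P ^ 2 = W.Ψ₂Sq.eval (xCoord P) := by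
  obtain ⟨x, y, h, rfl⟩ := exists_some_of_ne_zero hP
  have := (W.toAffine.equation_iff x y).mp h.1
  simp only [etaCoord_some, xCoord_some, Ψ₂Sq, b₂, b₄, b₆, eval_add, eval_mul, eval_C, eval_pow,
    eval_X]
  linear_combination 4 * this

theorem eq_of_coord_eq [NeZero (2 : F)] {P Q : W.toAffine.Point} (hP : P ≠ 0) (hQ : Q ≠ 0)
    (hx : xCoord P = xCoord Q) (hη : etaCoord P = etaCoord Q) : P = Q := by
  obtain ⟨x, y, h, rfl⟩ := exists_some_of_ne_zero hP
  obtain ⟨x', y', h', rfl⟩ := exists_some_of_ne_zero hQ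
  simp only [xCoord_some, etaCoord_some] at hx hη
  subst hx
  have : y = y' := mul_left_cancel₀ (two_ne_zero (α := F)) (by linear_combination hη)
  subst this
  rfl

theorem eq_or_eq_neg_of_xCoord_eq {P Q : W.toAffine.Point} (hP : P ≠ 0) (hQ : Q ≠ 0)
    (hx : xCoord P = xCoord Q) : P = Q ∨ P = -Q := by
  obtain ⟨x, y, h, rfl⟩ := exists_some_of_ne_zero hP
  obtain ⟨x', y', h', rfl⟩ := exists_some_of_ne_zero hQ
  exact Affine.Point.X_eq_iff.mp hx

theorem finite_xCoord_fiber (c : F) : {P : W.toAffine.Point | xCoord P = c}.Finite := by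
  by_cases h : ∃ Q : W.toAffine.Point, Q ≠ 0 ∧ xCoord Q = c
  · obtain ⟨Q, hQ, hQc⟩ := h
    refine (Set.toFinite {0, Q, -Q}).subset fun P hP => ?_
    by_cases hP0 : P = 0
    · simp [hP0]
    · rcases eq_or_eq_neg_of_xCoord_eq hP0 hQ (hP.trans hQc.symm) with h | h <;> simp [h]
  · push Not at h
    refine (Set.toFinite {0}).subset fun P hP => ?_
    by_contra hP0
    exact h P hP0 hP

theorem tendsto_xCoord : Tendsto (xCoord : W.toAffine.Point → F) cofinite cofinite :=
  Tendsto.cofinite_of_finite_preimage_singleton fun c => finite_xCoord_fiber c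

theorem eventually_ne_zero : ∀ᶠ P : W.toAffine.Point in cofinite, P ≠ 0 :=
  (Set.finite_singleton 0).eventually_cofinite_notMem

theorem eventually_eval_ne_zero {q : F[X]} (hq : q ≠ 0) :
    ∀ᶠ P : W.toAffine.Point in cofinite, q.eval (xCoord P) ≠ 0 := by
  have : ∀ᶠ x : F in cofinite, x ∉ {x | IsRoot q x} :=
    (Polynomial.finite_setOfPred_isRoot hq).eventually_cofinite_notMem
  exact tendsto_xCoord.eventually this

theorem etaCoord_ne_zero_iff {P : W.toAffine.Point} (hP : P ≠ 0) :
    etaCoord P ≠ 0 ↔ W.Ψ₂Sq.eval (xCoord P) ≠ 0 := by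
  rw [← etaCoord_sq hP, ne_eq, ne_eq, pow_eq_zero_iff two_ne_zero]

/-- The last clause is the formula [2]*ω = 2ω for the invariant differential ω = dx/η. -/
theorem two_add_self [DecidableEq F] {P : W.toAffine.Point} (hP : P ≠ 0)
    (hη : etaCoord P ≠ 0) [NeZero (2 : F)] :
    P + P ≠ 0 ∧ xCoord (P + P) = (W.Φ 2).eval (xCoord P) / W.Ψ₂Sq.eval (xCoord P) ∧
      etaCoord (P + P) = etaCoord P * (2⁻¹ *
        ((derivative (W.Φ 2) * W.Ψ₂Sq - W.Φ 2 * derivative W.Ψ₂Sq).eval (xCoord P) /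
          W.Ψ₂Sq.eval (xCoord P) ^ 2)) := by
  rw [← etaCoord_sq hP]
  obtain ⟨x, y, h, rfl⟩ := exists_some_of_ne_zero hP
  have hy : y ≠ W.toAffine.negY x y := by
    intro he
    apply hη
    rw [etaCoord_some]
    rw [Affine.negY] at he
    linear_combination he
  rw [Affine.Point.add_self_of_Y_ne hy]
  have hslope := Affine.slope_of_Y_ne (W := W.toAffine) rfl hy
  rw [show y - W.toAffine.negY x y = 2 * y + W.a₁ * x + W.a₃ by rw [Affine.negY]; ring] at hslope
  have heq := (W.toAffine.equation_iff x y).mp h.1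
  set e := 2 * y + W.a₁ * x + W.a₃ with he
  have hee : etaCoord (Affine.Point.some x y h) = e := rfl
  rw [hee] at hη ⊢
  have h2 : (2 : F) ≠ 0 := two_ne_zero
  have hy' : y = (e - W.a₁ * x - W.a₃) / 2 := by rw [he]; field_simp; ring
  -- Eliminating y in favour of e and a₆ through the equation leaves identities of rational
  -- functions in x, e and the other coefficients.
  have ha6 : W.a₆ = y ^ 2 + W.a₁ * x * y + W.a₃ * y - (x ^ 3 + W.a₂ * x ^ 2 + W.a₄ * x) := by
    linear_combination -heq
  clear_value e
  refine ⟨Affine.Point.some_ne_zero _, ?_, ?_⟩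
  · rw [xCoord_some, hslope, Affine.addX, Φ_two]
    simp only [eval_sub, eval_mul, eval_C, eval_pow, eval_X, b₄, b₆, b₈, xCoord_some]
    rw [ha6, hy']
    field_simp
    ring
  · rw [etaCoord_some, hslope, Affine.addY, Affine.negAddY, Affine.addX, Affine.negY, Φ_two]
    simp only [Ψ₂Sq, eval_add, eval_sub, eval_mul, eval_C, eval_pow, eval_X, b₂, b₄, b₆, b₈,
      derivative_add, derivative_sub, derivative_mul, derivative_C, derivative_X_pow, xCoord_some,
      derivative_X, eval_zero, eval_one, Nat.cast_ofNat, Nat.add_one_sub_one]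
    rw [ha6, hy']
    field_simp
    ring

/-- The chord formula in terms of η. Negation changes the sign of η, whence the sum in the
numerator; of the coefficients only b₂ survives. -/
theorem xCoord_sub [DecidableEq F] {P Q : W.toAffine.Point} (hP : P ≠ 0) (hQ : Q ≠ 0)
    (hx : xCoord P ≠ xCoord Q) [NeZero (2 : F)] :
    xCoord (P - Q) = (etaCoord P + etaCoord Q) ^ 2 / (4 * (xCoord P - xCoord Q) ^ 2) - W.b₂ / 4
      - xCoord P - xCoord Q := by
  obtain ⟨x, y, h, rfl⟩ := exists_some_of_ne_zero hP
  obtain ⟨x', y', h', rfl⟩ := exists_some_of_ne_zero hQ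
  simp only [xCoord_some] at hx
  have h2 : (2 : F) ≠ 0 := two_ne_zero
  have h4 : (4 : F) ≠ 0 := by
    rw [show (4 : F) = 2 * 2 by norm_num]; exact mul_ne_zero h2 h2
  have hd : x - x' ≠ 0 := sub_ne_zero.mpr hx
  rw [sub_eq_add_neg, Affine.Point.neg_some, Affine.Point.add_of_X_ne hx, xCoord_some,
    Affine.slope_of_X_ne hx, Affine.addX, Affine.negY, etaCoord_some, etaCoord_some, xCoord_some,
    xCoord_some, b₂]
  field_simp
  ring

theorem infinite_point [IsAlgClosed F] [W.IsElliptic] : Infinite W.toAffine.Point := by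
  have h (x : F) : ∃ P : W.toAffine.Point, xCoord P = x := by
    obtain ⟨y, hy⟩ := IsAlgClosed.exists_root
      (X ^ 2 + C (W.a₁ * x + W.a₃) * X - C (x ^ 3 + W.a₂ * x ^ 2 + W.a₄ * x + W.a₆) : F[X])
      (by
        have : (X ^ 2 + C (W.a₁ * x + W.a₃) * X -
            C (x ^ 3 + W.a₂ * x ^ 2 + W.a₄ * x + W.a₆) : F[X]).degree = 2 := by
          compute_degree!
        rw [this]; decide)
    have heq : W.toAffine.Equation x y := by
      rw [Affine.equation_iff]
      simp only [IsRoot.def, eval_add, eval_sub, eval_mul, eval_C, eval_pow, eval_X] at hy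
      linear_combination hy
    exact ⟨.some x y ((Affine.equation_iff_nonsingular).mp heq), rfl⟩
  have : Infinite F := IsAlgClosed.instInfinite
  exact Infinite.of_surjective xCoord h

end Coordinates

/-! ### Functions on points up to finite sets, and the form of a homomorphism -/

section Germs

open Polynomial Filter

variable {F : Type*} [Field F]

/-- Germs at infinity of `F`-valued functions on the set of points of `W`: functions up to equality
outside of a finite set. -/
abbrev PtGerm (W : WeierstrassCurve F) : Type _ := Germ (cofinite : Filter W.toAffine.Point) F

/-- The germ of a polynomial in the `x`-coordinate. -/
noncomputable def polyGerm (W : WeierstrassCurve F) : F[X] →+* PtGerm W :=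
  (Germ.coeRingHom cofinite).comp (RingHom.pi fun P => evalRingHom (xCoord P))

theorem polyGerm_apply (W : WeierstrassCurve F) (p : F[X]) :
    polyGerm W p = ((fun P => p.eval (xCoord P) : W.toAffine.Point → F) : PtGerm W) := rfl

theorem polyGerm_mul_inv (W : WeierstrassCurve F) {p : F[X]} (hp : p ≠ 0) :
    polyGerm W p * ((fun P => (p.eval (xCoord P))⁻¹ : W.toAffine.Point → F) : PtGerm W) = 1 := by
  rw [polyGerm_apply, ← Germ.coe_mul, ← Germ.coe_one, Germ.coe_eq]
  filter_upwards [eventually_eval_ne_zero hp] with P h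
  exact mul_inv_cancel₀ h

/-- The germ of a rational function in the `x`-coordinate. -/
noncomputable def evalGerm (W : WeierstrassCurve F) : RatFunc F →+* PtGerm W :=
  IsLocalization.lift (M := nonZeroDivisors F[X]) (S := RatFunc F) (g := polyGerm W)
    (fun p => IsUnit.of_mul_eq_one _ (polyGerm_mul_inv W (nonZeroDivisors.ne_zero p.2)))

theorem evalGerm_algebraMap (W : WeierstrassCurve F) (p : F[X]) :
    evalGerm W (algebraMap F[X] (RatFunc F) p) =
      ((fun P => p.eval (xCoord P) : W.toAffine.Point → F) : PtGerm W) :=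
  IsLocalization.lift_eq _ _

theorem evalGerm_C (W : WeierstrassCurve F) (a : F) :
    evalGerm W (RatFunc.C a) = ((fun _ => a : W.toAffine.Point → F) : PtGerm W) := by
  rw [← RatFunc.algebraMap_C, evalGerm_algebraMap]
  simp

theorem evalGerm_X (W : WeierstrassCurve F) :
    evalGerm W RatFunc.X = ((fun P => xCoord P : W.toAffine.Point → F) : PtGerm W) := by
  rw [← RatFunc.algebraMap_X, evalGerm_algebraMap]
  simp

theorem evalGerm_div (W : WeierstrassCurve F) (p : F[X]) {q : F[X]} (hq : q ≠ 0) :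
    evalGerm W (algebraMap F[X] (RatFunc F) p / algebraMap F[X] (RatFunc F) q) =
      ((fun P => p.eval (xCoord P) / q.eval (xCoord P) : W.toAffine.Point → F) : PtGerm W) := by
  have h := polyGerm_mul_inv W hq
  have h2 : evalGerm W (algebraMap F[X] (RatFunc F) p / algebraMap F[X] (RatFunc F) q) *
      polyGerm W q = polyGerm W p := by
    rw [polyGerm_apply, polyGerm_apply, ← evalGerm_algebraMap, ← evalGerm_algebraMap, ← map_mul,
      div_mul_cancel₀ _ (RatFunc.algebraMap_ne_zero hq)]
  rw [← mul_one (evalGerm W _), ← h, ← mul_assoc, h2, polyGerm_apply, ← Germ.coe_mul]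
  simp only [div_eq_mul_inv]
  rfl

/-- The source is a field, and the ring of germs is nontrivial because the cofinite filter on an
infinite set is proper. -/
theorem evalGerm_injective (W : WeierstrassCurve F) [Infinite W.toAffine.Point] :
    Function.Injective (evalGerm W) := (evalGerm W).injective

/-- The germ of `η`. -/
def etaGerm (W : WeierstrassCurve F) : PtGerm W :=
  ((fun P => etaCoord P : W.toAffine.Point → F) : PtGerm W)

theorem etaGerm_sq (W : WeierstrassCurve F) :
    etaGerm W ^ 2 = evalGerm W (algebraMap F[X] (RatFunc F) W.Ψ₂Sq) := by
  rw [evalGerm_algebraMap, etaGerm, ← Germ.coe_pow, Germ.coe_eq]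
  filter_upwards [eventually_ne_zero] with P h
  exact etaCoord_sq h

theorem ratPsi_ne_zero [CharZero F] (W : WeierstrassCurve F) :
    algebraMap F[X] (RatFunc F) W.Ψ₂Sq ≠ 0 :=
  RatFunc.algebraMap_ne_zero (W.Ψ₂Sq_ne_zero (by norm_num))

theorem isUnit_etaGerm [CharZero F] (W : WeierstrassCurve F) : IsUnit (etaGerm W) := by
  rw [← isUnit_pow_iff two_ne_zero, etaGerm_sq]
  exact (isUnit_iff_ne_zero.mpr (ratPsi_ne_zero W)).map _

theorem eventually_etaCoord_ne_zero [CharZero F] (W : WeierstrassCurve F) :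
    ∀ᶠ P : W.toAffine.Point in cofinite, etaCoord P ≠ 0 := by
  filter_upwards [eventually_ne_zero, eventually_eval_ne_zero (W.Ψ₂Sq_ne_zero (by norm_num))]
    with P h h2
  exact (etaCoord_ne_zero_iff h).mpr h2

/-- The pull-back of germs along a map with finite fibres. -/
def pullback {W₁ W₂ : WeierstrassCurve F} {φ : W₁.toAffine.Point → W₂.toAffine.Point}
    (hφ : Tendsto φ cofinite cofinite) : PtGerm W₂ →+* PtGerm W₁ where
  toFun u := u.compTendsto φ hφ
  map_one' := rfl
  map_zero' := rfl
  map_mul' u v := by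
    induction u, v using Germ.inductionOn₂ with | h u v => rfl
  map_add' u v := by
    induction u, v using Germ.inductionOn₂ with | h u v => rfl

theorem pullback_coe {W₁ W₂ : WeierstrassCurve F} {φ : W₁.toAffine.Point → W₂.toAffine.Point}
    (hφ : Tendsto φ cofinite cofinite) (u : W₂.toAffine.Point → F) :
    pullback hφ (u : PtGerm W₂) = ((fun P => u (φ P) : W₁.toAffine.Point → F) : PtGerm W₁) := rfl

variable [DecidableEq F]

/-- The kernel is finite, and every nonempty fibre is a coset of it. -/
theorem tendsto_cofinite_of_eventually_ne_zero {A B : Type*} [AddGroup A] [AddGroup B]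
    {φ : A →+ B} (h : ∀ᶠ P in cofinite, φ P ≠ 0) : Tendsto φ cofinite cofinite := by
  have hker : {P | φ P = 0}.Finite := by simpa [Filter.eventually_cofinite] using h
  refine Tendsto.cofinite_of_finite_preimage_singleton fun Q => ?_
  by_cases hQ : ∃ P, φ P = Q
  · obtain ⟨P, rfl⟩ := hQ
    refine (hker.image (fun T => P + T)).subset fun T hT => ?_
    have hT' : φ T = φ P := hT
    exact ⟨-P + T, by simp [hT'], by simp⟩
  · rw [Set.eq_empty_of_forall_notMem (s := φ ⁻¹' {Q}) fun P h => hQ ⟨P, h⟩]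
    exact Set.finite_empty

/-- The homomorphism `φ` is given by `x ↦ f(x)`, `η ↦ η g(x)` outside of a finite set. -/
structure HasForm {W₁ W₂ : WeierstrassCurve F} (φ : W₁.toAffine.Point →+ W₂.toAffine.Point)
    (f g : RatFunc F) : Prop where
  ne_zero : ∀ᶠ P in cofinite, φ P ≠ 0
  x_eq : ((fun P => xCoord (φ P) : W₁.toAffine.Point → F) : PtGerm W₁) = evalGerm W₁ f
  eta_eq : ((fun P => etaCoord (φ P) : W₁.toAffine.Point → F) : PtGerm W₁) =
    etaGerm W₁ * evalGerm W₁ g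

namespace HasForm

variable {W₁ W₂ W₃ : WeierstrassCurve F} {φ : W₁.toAffine.Point →+ W₂.toAffine.Point}
  {ψ : W₂.toAffine.Point →+ W₃.toAffine.Point} {f g f' g' : RatFunc F}

theorem tendsto (h : HasForm φ f g) : Tendsto φ cofinite cofinite :=
  tendsto_cofinite_of_eventually_ne_zero h.ne_zero

theorem pullback_X (h : HasForm φ f g) :
    pullback h.tendsto (evalGerm W₂ RatFunc.X) = evalGerm W₁ f := by
  rw [evalGerm_X, pullback_coe, h.x_eq]

theorem pullback_eta (h : HasForm φ f g) :
    pullback h.tendsto (etaGerm W₂) = etaGerm W₁ * evalGerm W₁ g := by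
  rw [etaGerm, pullback_coe, h.eta_eq]

theorem pullback_algebraMap (h : HasForm φ f g) (p : F[X]) :
    pullback h.tendsto (evalGerm W₂ (algebraMap F[X] (RatFunc F) p)) =
      evalGerm W₁ (aeval f p) := by
  have : ((pullback h.tendsto).comp (evalGerm W₂)).comp (algebraMap F[X] (RatFunc F)) =
      (evalGerm W₁).comp ((aeval f : F[X] →ₐ[F] RatFunc F) : F[X] →+* RatFunc F) := by
    apply Polynomial.ringHom_ext
    · intro a
      simp only [RingHom.comp_apply, RatFunc.algebraMap_C, evalGerm_C, pullback_coe, RingHom.coe_coe,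
        aeval_C, RatFunc.algebraMap_eq_C]
    · simpa using h.pullback_X
  exact congrArg (fun u => u p) this

/-- A nonzero polynomial in x is an invertible germ on the target, and pull-back preserves units; a
relation p(f) = 0 would make 0 a unit. -/
theorem transcendental [Infinite W₁.toAffine.Point] (h : HasForm φ f g) : Transcendental F f := by
  rw [transcendental_iff]
  intro p hp
  by_contra hp0
  have h1 := h.pullback_algebraMap p
  rw [hp, map_zero] at h1
  have h2 := (((isUnit_iff_ne_zero.mpr (RatFunc.algebraMap_ne_zero hp0)).map (evalGerm W₂)).map
    (pullback h.tendsto))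
  rw [h1] at h2
  exact not_isUnit_zero h2

/-- The substitution `r ↦ r(f)` attached to a homomorphism of the form `x ↦ f(x)`. -/
noncomputable def subst [Infinite W₁.toAffine.Point] (h : HasForm φ f g) :
    RatFunc F →ₐ[F] RatFunc F := ratSubst f h.transcendental

theorem subst_X [Infinite W₁.toAffine.Point] (h : HasForm φ f g) : h.subst RatFunc.X = f :=
  ratSubst_X f _

theorem pullback_evalGerm [Infinite W₁.toAffine.Point] (h : HasForm φ f g) (r : RatFunc F) :
    pullback h.tendsto (evalGerm W₂ r) = evalGerm W₁ (h.subst r) := by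
  have : (pullback h.tendsto).comp (evalGerm W₂) =
      (evalGerm W₁).comp (h.subst : RatFunc F →+* RatFunc F) := by
    apply RatFunc.ringHom_ext
    · intro a
      simp only [RingHom.comp_apply, evalGerm_C, pullback_coe, RingHom.coe_coe, ratAlgHom_C]
    · simpa [h.subst_X] using h.pullback_X
  exact congrArg (fun u => u r) this

/-- The multiplier of η obeys a cocycle rule: η becomes η·g under φ, and g' is evaluated at f. -/
theorem comp [Infinite W₁.toAffine.Point] (h' : HasForm ψ f' g') (h : HasForm φ f g) :
    HasForm (ψ.comp φ) (h.subst f') (g * h.subst g') where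
  ne_zero := h.tendsto.eventually h'.ne_zero
  x_eq := by
    rw [← h.pullback_evalGerm, ← h'.x_eq]
    rfl
  eta_eq := by
    rw [map_mul, ← h.pullback_evalGerm, ← mul_assoc, ← h.pullback_eta, ← map_mul, ← h'.eta_eq]
    rfl

theorem unique [CharZero F] [Infinite W₁.toAffine.Point] (h : HasForm φ f g)
    (h' : HasForm φ f' g') : f = f' ∧ g = g' :=
  ⟨evalGerm_injective W₁ (h.x_eq.symm.trans h'.x_eq),
    evalGerm_injective W₁ ((isUnit_etaGerm W₁).mul_left_cancel (h.eta_eq.symm.trans h'.eta_eq))⟩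

/-- The equations of the two curves, in terms of the form of a homomorphism. -/
theorem sq_mul [Infinite W₁.toAffine.Point] (h : HasForm φ f g) :
    g ^ 2 * algebraMap F[X] (RatFunc F) W₁.Ψ₂Sq = aeval f W₂.Ψ₂Sq := by
  apply evalGerm_injective W₁
  rw [← h.pullback_algebraMap, ← etaGerm_sq, map_pow, h.pullback_eta, map_mul, ← etaGerm_sq,
    map_pow]
  ring

theorem g_ne_zero [CharZero F] [Infinite W₁.toAffine.Point] (h : HasForm φ f g) : g ≠ 0 := by
  rintro rfl
  have h1 := h.sq_mul
  rw [zero_pow two_ne_zero, zero_mul, eq_comm] at h1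
  exact W₂.Ψ₂Sq_ne_zero (by norm_num) (transcendental_iff.mp h.transcendental _ h1)

theorem ratDeriv_ne_zero [CharZero F] [Infinite W₁.toAffine.Point] (h : HasForm φ f g) :
    ratDeriv f ≠ 0 := by
  intro h0
  obtain ⟨a, rfl⟩ := exists_C_of_ratDeriv_eq_zero h0
  refine h.transcendental ?_
  rw [← RatFunc.algebraMap_eq_C]
  exact isAlgebraic_algebraMap a

/-- The doubling map multiplies the invariant differential by `2`. -/
theorem double [CharZero F] (W : WeierstrassCurve F) :
    HasForm (nsmulAddMonoidHom 2 : W.toAffine.Point →+ W.toAffine.Point)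
      (algebraMap F[X] (RatFunc F) (W.Φ 2) / algebraMap F[X] (RatFunc F) W.Ψ₂Sq)
      (RatFunc.C 2⁻¹ * ratDeriv
        (algebraMap F[X] (RatFunc F) (W.Φ 2) / algebraMap F[X] (RatFunc F) W.Ψ₂Sq)) := by
  have hψ : W.Ψ₂Sq ≠ 0 := W.Ψ₂Sq_ne_zero (by norm_num)
  have key : ∀ᶠ P : W.toAffine.Point in cofinite, P ≠ 0 ∧ etaCoord P ≠ 0 :=
    eventually_ne_zero.and (eventually_etaCoord_ne_zero W)
  refine ⟨?_, ?_, ?_⟩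
  · filter_upwards [key] with P hP
    rw [nsmulAddMonoidHom_apply, two_nsmul]
    exact (two_add_self hP.1 hP.2).1
  · rw [evalGerm_div W _ hψ, Germ.coe_eq]
    filter_upwards [key] with P hP
    rw [nsmulAddMonoidHom_apply, two_nsmul]
    exact (two_add_self hP.1 hP.2).2.1
  · rw [ratDeriv_div, ← map_pow, map_mul, evalGerm_C, evalGerm_div W _ (pow_ne_zero 2 hψ), etaGerm,
      ← Germ.coe_mul, ← Germ.coe_mul, Germ.coe_eq]
    filter_upwards [key] with P hP
    rw [nsmulAddMonoidHom_apply, two_nsmul, (two_add_self hP.1 hP.2).2.2]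
    simp

/-- The pull-back of the invariant differential is a constant multiple of the invariant
differential. -/
theorem exists_ratDeriv_eq [CharZero F] [Infinite W₁.toAffine.Point] [Infinite W₂.toAffine.Point]
    (h : HasForm φ f g) :
    ∃ l : F, l ≠ 0 ∧ g = RatFunc.C (1 / l) * ratDeriv f := by
  have hd₁ := double W₁
  have hd₂ := double W₂
  set d₁ := algebraMap F[X] (RatFunc F) (W₁.Φ 2) / algebraMap F[X] (RatFunc F) W₁.Ψ₂Sq with hdef₁
  set d₂ := algebraMap F[X] (RatFunc F) (W₂.Φ 2) / algebraMap F[X] (RatFunc F) W₂.Ψ₂Sq with hdef₂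
  -- Both sides of φ∘[2] = [2]∘φ have a form. Uniqueness compares them, and the x-parts are then
  -- differentiated by the chain rule.
  have hcomm : φ.comp (nsmulAddMonoidHom 2) = (nsmulAddMonoidHom 2).comp φ := by
    ext P; simp
  have h1 := h.comp hd₁
  have h2 := hd₂.comp h
  rw [hcomm] at h1
  obtain ⟨hf, hg⟩ := h1.unique h2
  have hf' := congrArg ratDeriv hf
  rw [ratDeriv_algHom hd₁.subst, ratDeriv_algHom h.subst, hd₁.subst_X, h.subst_X] at hf'
  rw [map_mul, ratAlgHom_C] at hg
  have h2C : (RatFunc.C (2⁻¹ : F)) ≠ 0 := by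
    rw [ne_eq, ← map_zero (RatFunc.C (K := F)), RatFunc.C_injective.eq_iff]
    norm_num
  have hD₁ : ratDeriv d₁ ≠ 0 := hd₁.ratDeriv_ne_zero
  have hg0 := h.g_ne_zero
  have hsg : hd₁.subst g ≠ 0 := (_root_.map_ne_zero _).mpr hg0
  have hg' : ratDeriv d₁ * hd₁.subst g = g * h.subst (ratDeriv d₂) :=
    mul_left_cancel₀ h2C (by linear_combination hg)
  -- The factor 2 of doubling occurs on both sides and cancels, which leaves f'/g invariant.
  have hinv : hd₁.subst (ratDeriv f / g) = ratDeriv f / g := by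
    rw [map_div₀, div_eq_div_iff hsg hg0]
    apply mul_left_cancel₀ hD₁
    linear_combination g * hf' - ratDeriv f * hg'
  have h4 : (4 : F) ≠ 0 := by norm_num
  -- Doubling is x ↦ Φ₂/Ψ₂² with degrees 4 and 3, monic numerator and leading coefficient 4 below;
  -- powers of 4 are distinct in characteristic 0.
  obtain ⟨c, hc⟩ := exists_C_of_invariant (W₁.Ψ₂Sq_ne_zero h4) (W₁.leadingCoeff_Φ 2)
    (by rw [W₁.natDegree_Ψ₂Sq h4, W₁.natDegree_Φ]; decide)
    (by
      rw [W₁.leadingCoeff_Ψ₂Sq h4]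
      intro m n hmn
      have : ((4 ^ m : ℕ) : F) = ((4 ^ n : ℕ) : F) := by simpa using hmn
      exact Nat.pow_right_injective (by norm_num) (Nat.cast_injective this))
    hd₁.subst hd₁.subst_X hinv
  rw [div_eq_iff hg0] at hc
  have hc0 : c ≠ 0 := by
    rintro rfl
    exact h.ratDeriv_ne_zero (by rw [hc]; simp)
  refine ⟨c, hc0, ?_⟩
  rw [hc, ← mul_assoc, ← map_mul, one_div, inv_mul_cancel₀ hc0, map_one, one_mul]

end HasForm

end Germs

/-! ### Standard form and factor of an isogeny -/

section StandardForm

open Polynomial Filter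

variable {F : Type*} [Field F]

/-- Since y is linear in η over F[x] and η² = `Ψ₂Sq`(x), the functions 1 and η span the coordinate
ring over F[x]. -/
theorem exists_repr_add_mul_eta [CharZero F] (W : WeierstrassCurve F)
    (p : MvPolynomial (Fin 2) F) :
    ∃ A B : F[X], ∀ P : W.toAffine.Point, P ≠ 0 →
      MvPolynomial.aeval ![xCoord P, yCoord P] p =
        A.eval (xCoord P) + B.eval (xCoord P) * etaCoord P := by
  induction p using MvPolynomial.induction_on with
  | C a => exact ⟨C a, 0, fun P _ => by simp⟩
  | add p q hp hq =>
    obtain ⟨A, B, h⟩ := hp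
    obtain ⟨A', B', h'⟩ := hq
    refine ⟨A + A', B + B', fun P hP => ?_⟩
    rw [map_add, h P hP, h' P hP, eval_add, eval_add]
    ring
  | mul_X p i hp =>
    obtain ⟨A, B, h⟩ := hp
    fin_cases i
    · refine ⟨A * X, B * X, fun P hP => ?_⟩
      rw [map_mul, h P hP, MvPolynomial.aeval_X, eval_mul, eval_mul, eval_X]
      simp only [Fin.zero_eta, Matrix.cons_val_zero]
      ring
    · refine ⟨C 2⁻¹ * (B * W.Ψ₂Sq - A * (C W.a₁ * X + C W.a₃)),
        C 2⁻¹ * (A - B * (C W.a₁ * X + C W.a₃)), fun P hP => ?_⟩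
      have hy : yCoord P = 2⁻¹ * (etaCoord P - (W.a₁ * xCoord P + W.a₃)) := by
        rw [etaCoord]; field_simp; ring
      rw [map_mul, h P hP, MvPolynomial.aeval_X]
      simp only [eval_mul, eval_sub, eval_add, eval_C, eval_X, ← etaCoord_sq hP, Fin.mk_one,
        Matrix.cons_val_one, Matrix.cons_val_fin_one]
      rw [hy]
      ring

theorem tendsto_neg_cofinite {A : Type*} [AddGroup A] :
    Tendsto (fun P : A => -P) cofinite cofinite :=
  neg_injective.tendsto_cofinite

theorem exists_germ_eq_add_mul_eta [CharZero F] (W : WeierstrassCurve F)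
    [DecidableEq F] [Infinite W.toAffine.Point] (p q : MvPolynomial (Fin 2) F)
    (hq : ∀ᶠ P : W.toAffine.Point in cofinite,
      MvPolynomial.aeval ![xCoord P, yCoord P] q ≠ 0) :
    ∃ α β : RatFunc F, ((fun P => MvPolynomial.aeval ![xCoord P, yCoord P] p /
      MvPolynomial.aeval ![xCoord P, yCoord P] q : W.toAffine.Point → F) : PtGerm W) =
        evalGerm W α + etaGerm W * evalGerm W β := by
  obtain ⟨A, B, hAB⟩ := exists_repr_add_mul_eta W p
  obtain ⟨C, D, hCD⟩ := exists_repr_add_mul_eta W q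
  -- The norm of C + Dη over F(x). It is the product of the values of the denominator at P and −P,
  -- so it is nonzero at almost all points.
  set N := C ^ 2 - D ^ 2 * W.Ψ₂Sq with hN
  have hN' : ∀ᶠ P : W.toAffine.Point in cofinite,
      N.eval (xCoord P) ≠ 0 ∧ P ≠ 0 ∧ MvPolynomial.aeval ![xCoord P, yCoord P] q ≠ 0 := by
    filter_upwards [hq, eventually_ne_zero, tendsto_neg_cofinite.eventually hq] with P h1 h2 h3
    refine ⟨?_, h2, h1⟩
    rw [hCD P h2] at h1
    rw [hCD (-P) (neg_ne_zero.mpr h2), etaCoord_neg h2, xCoord_neg] at h3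
    rw [hN, eval_sub, eval_mul, eval_pow, eval_pow, ← etaCoord_sq h2]
    intro h0
    exact mul_ne_zero h1 h3 (by linear_combination h0)
  have hN0 : N ≠ 0 := by
    obtain ⟨P, hP, -⟩ := hN'.exists
    rintro h
    rw [h] at hP
    simp at hP
  refine ⟨algebraMap F[X] (RatFunc F) (A * C - B * D * W.Ψ₂Sq) / algebraMap F[X] (RatFunc F) N,
    algebraMap F[X] (RatFunc F) (B * C - A * D) / algebraMap F[X] (RatFunc F) N, ?_⟩
  rw [evalGerm_div W _ hN0, evalGerm_div W _ hN0, etaGerm, ← Germ.coe_mul, ← Germ.coe_add,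
    Germ.coe_eq]
  filter_upwards [hN'] with P ⟨h1, h2, h3⟩
  simp only [Pi.add_apply, Pi.mul_apply]
  rw [hAB P h2]
  rw [hCD P h2] at h3 ⊢
  rw [← mul_div_assoc, ← add_div, div_eq_div_iff h3 h1]
  rw [hN]
  simp only [eval_sub, eval_mul, eval_pow, ← etaCoord_sq h2]
  ring

theorem pullback_neg_evalGerm [DecidableEq F] (W : WeierstrassCurve F) (r : RatFunc F) :
    pullback (tendsto_neg_cofinite (A := W.toAffine.Point)) (evalGerm W r) = evalGerm W r := by
  induction r using RatFunc.induction_on with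
  | f p q hq =>
    rw [evalGerm_div W _ hq, pullback_coe]
    simp only [xCoord_neg]

theorem pullback_neg_etaGerm [DecidableEq F] (W : WeierstrassCurve F) :
    pullback (tendsto_neg_cofinite (A := W.toAffine.Point)) (etaGerm W) = -etaGerm W := by
  rw [etaGerm, pullback_coe, ← Germ.coe_neg, Germ.coe_eq]
  filter_upwards [eventually_ne_zero] with P h
  exact etaCoord_neg h

variable [DecidableEq F] {W₁ W₂ W₃ : WeierstrassCurve F}

/-- The standard form of a homomorphism given by rational functions. -/
theorem IsRationalOver.exists_hasForm [CharZero F] [Infinite W₁.toAffine.Point]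
    {φ : W₁.toAffine.Point →+ W₂.toAffine.Point} (hφ : IsRationalOver F φ) :
    ∃ f g, HasForm φ f g := by
  obtain ⟨p, q, r, s, h⟩ := hφ
  have h' : ∀ᶠ P : W₁.toAffine.Point in cofinite, φ P ≠ 0 ∧
      MvPolynomial.aeval ![xCoord P, yCoord P] q ≠ 0 ∧
      MvPolynomial.aeval ![xCoord P, yCoord P] s ≠ 0 ∧
      xCoord (φ P) = MvPolynomial.aeval ![xCoord P, yCoord P] p /
        MvPolynomial.aeval ![xCoord P, yCoord P] q ∧
      yCoord (φ P) = MvPolynomial.aeval ![xCoord P, yCoord P] r /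
        MvPolynomial.aeval ![xCoord P, yCoord P] s := by
    filter_upwards [h] with P ⟨x, y, hxy, x', y', hxy', hP, hφP, hq, hs, hx, hy⟩
    rw [hφP, hP]
    exact ⟨Affine.Point.some_ne_zero _, hq, hs, hx, hy⟩
  have hne : ∀ᶠ P in cofinite, φ P ≠ 0 := h'.mono fun P h => h.1
  obtain ⟨α, β, hαβ⟩ := exists_germ_eq_add_mul_eta W₁ p q (h'.mono fun P h => h.2.1)
  obtain ⟨γ, δ, hγδ⟩ := exists_germ_eq_add_mul_eta W₁ r s (h'.mono fun P h => h.2.2.1)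
  have hx : ((fun P => xCoord (φ P) : W₁.toAffine.Point → F) : PtGerm W₁) =
      evalGerm W₁ α + etaGerm W₁ * evalGerm W₁ β := by
    rw [← hαβ, Germ.coe_eq]
    exact h'.mono fun P h => h.2.2.2.1
  have hy : ((fun P => yCoord (φ P) : W₁.toAffine.Point → F) : PtGerm W₁) =
      evalGerm W₁ γ + etaGerm W₁ * evalGerm W₁ δ := by
    rw [← hγδ, Germ.coe_eq]
    exact h'.mono fun P h => h.2.2.2.2
  have hx' : ((fun P => xCoord (φ P) : W₁.toAffine.Point → F) : PtGerm W₁) =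
      evalGerm W₁ α - etaGerm W₁ * evalGerm W₁ β := by
    have := congrArg (pullback (tendsto_neg_cofinite (A := W₁.toAffine.Point))) hx
    rw [map_add, map_mul, pullback_neg_evalGerm, pullback_neg_evalGerm, pullback_neg_etaGerm,
      pullback_coe] at this
    simp only [map_neg, xCoord_neg] at this
    rw [this]
    ring
  have hy' : ((fun P => yCoord (-φ P) : W₁.toAffine.Point → F) : PtGerm W₁) =
      evalGerm W₁ γ - etaGerm W₁ * evalGerm W₁ δ := by
    have := congrArg (pullback (tendsto_neg_cofinite (A := W₁.toAffine.Point))) hy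
    rw [map_add, map_mul, pullback_neg_evalGerm, pullback_neg_evalGerm, pullback_neg_etaGerm,
      pullback_coe] at this
    simp only [map_neg] at this
    rw [this]
    ring
  -- As φ commutes with negation, x∘φ is even and loses its η-part, while η∘φ = y(φP) − y(−φP) is
  -- twice the odd part of y∘φ.
  refine ⟨α, 2 * δ, hne, ?_, ?_⟩
  · have hu : IsUnit (2 : PtGerm W₁) := by
      have : (2 : PtGerm W₁) = evalGerm W₁ 2 := by rw [map_ofNat]
      rw [this]
      exact (isUnit_iff_ne_zero.mpr two_ne_zero).map _
    apply hu.mul_left_cancel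
    rw [two_mul]
    nth_rewrite 1 [hx]
    rw [hx']
    ring
  · have : ((fun P => etaCoord (φ P) : W₁.toAffine.Point → F) : PtGerm W₁) =
        ((fun P => yCoord (φ P) : W₁.toAffine.Point → F) : PtGerm W₁) -
          ((fun P => yCoord (-φ P) : W₁.toAffine.Point → F) : PtGerm W₁) := by
      rw [← Germ.coe_sub, Germ.coe_eq]
      filter_upwards [hne] with P hP
      exact (yCoord_sub_yCoord_neg hP).symm
    rw [this, hy, hy', map_mul, map_ofNat]
    ring

/-- A homomorphism in standard form is given by rational functions over any field that contains
the coefficients. -/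
theorem HasForm.isRationalOver [CharZero F] {k : Type*} [Field k] [Algebra k F]
    {φ : W₁.toAffine.Point →+ W₂.toAffine.Point} {p q r s : k[X]}
    (hq : q ≠ 0) (hs : s ≠ 0)
    (h : HasForm φ
      (algebraMap F[X] (RatFunc F) (p.map (algebraMap k F)) /
        algebraMap F[X] (RatFunc F) (q.map (algebraMap k F)))
      (algebraMap F[X] (RatFunc F) (r.map (algebraMap k F)) /
        algebraMap F[X] (RatFunc F) (s.map (algebraMap k F))))
    {b₁ b₃ c₁ c₃ : k} (hb₁ : algebraMap k F b₁ = W₁.a₁) (hb₃ : algebraMap k F b₃ = W₁.a₃)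
    (hc₁ : algebraMap k F c₁ = W₂.a₁) (hc₃ : algebraMap k F c₃ = W₂.a₃) :
    IsRationalOver k φ := by
  have hq' : q.map (algebraMap k F) ≠ 0 := Polynomial.map_ne_zero hq
  have hs' : s.map (algebraMap k F) ≠ 0 := Polynomial.map_ne_zero hs
  have hx := h.x_eq
  have hη := h.eta_eq
  rw [evalGerm_div W₁ _ hq', Germ.coe_eq] at hx
  rw [evalGerm_div W₁ _ hs', etaGerm, ← Germ.coe_mul, Germ.coe_eq] at hη
  let ι : k[X] →ₐ[k] MvPolynomial (Fin 2) k := aeval (MvPolynomial.X 0)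
  have hι (t : k[X]) (x y : F) :
      MvPolynomial.aeval ![x, y] (ι t) = (t.map (algebraMap k F)).eval x := by
    rw [← Polynomial.aeval_algHom_apply, MvPolynomial.aeval_X, eval_map_algebraMap]
    simp
  -- The second coordinate is y' = (η' − c₁x' − c₃)/2 with x' = p/q and η' = η·r/s, over the common
  -- denominator 2sq.
  refine ⟨ι p, ι q, (2 * MvPolynomial.X 1 + MvPolynomial.C b₁ * MvPolynomial.X 0 +
    MvPolynomial.C b₃) * ι r * ι q - MvPolynomial.C c₁ * ι p * ι s - MvPolynomial.C c₃ * ι s * ι q,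
    2 * ι s * ι q, ?_⟩
  filter_upwards [hx, hη, h.ne_zero, eventually_ne_zero, eventually_eval_ne_zero hq',
    eventually_eval_ne_zero hs'] with P hx hη hφP hP hqP hsP
  obtain ⟨x, y, hxy, rfl⟩ := exists_some_of_ne_zero hP
  obtain ⟨x', y', hxy', hφ⟩ := exists_some_of_ne_zero hφP
  rw [hφ] at hx hη
  simp only [xCoord_some, etaCoord_some, Pi.mul_apply] at hx hη hqP hsP
  refine ⟨x, y, hxy, x', y', hxy', rfl, hφ, ?_, ?_, ?_, ?_⟩
  · rwa [hι]
  · rw [map_mul, map_mul, hι, hι, map_ofNat]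
    exact mul_ne_zero (mul_ne_zero two_ne_zero hsP) hqP
  · rwa [hι, hι]
  · simp only [map_sub, map_mul, map_add, hι, map_ofNat, MvPolynomial.aeval_X,
      MvPolynomial.algHom_C, hb₁, hb₃, hc₁, hc₃, Matrix.cons_val_zero, Matrix.cons_val_one,
      Matrix.cons_val_fin_one]
    rw [hx] at hη
    have hy : y' = ((2 * y + W₁.a₁ * x + W₁.a₃) * ((r.map (algebraMap k F)).eval x /
        (s.map (algebraMap k F)).eval x) - W₂.a₁ * ((p.map (algebraMap k F)).eval x /
        (q.map (algebraMap k F)).eval x) - W₂.a₃) / 2 := by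
      rw [← hη]; ring
    rw [hy]
    field_simp

theorem HasForm.isRationalOver_self [CharZero F]
    {φ : W₁.toAffine.Point →+ W₂.toAffine.Point} {f g : RatFunc F} (h : HasForm φ f g) :
    IsRationalOver F φ := by
  refine HasForm.isRationalOver (k := F) (p := f.num) (r := g.num) f.denom_ne_zero g.denom_ne_zero
    ?_ rfl rfl rfl rfl
  simpa [RatFunc.num_div_denom] using h

/-- Rephrases the factor as the relation g = f'/l, so that the calculus of forms applies to it. -/
theorem hasFactor_iff [CharZero F] [Infinite W₁.toAffine.Point] (φ : Isogeny W₁ W₂) (l : F) :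
    φ.HasFactor l ↔
      l ≠ 0 ∧ ∃ f, HasForm φ.toHom f (RatFunc.C (1 / l) * ratDeriv f) := by
  refine and_congr_right fun hl => ⟨?_, ?_⟩
  · rintro ⟨p, q, h⟩
    have h' : ∀ᶠ P : W₁.toAffine.Point in cofinite, φ.toHom P ≠ 0 ∧ q.eval (xCoord P) ≠ 0 ∧
        xCoord (φ.toHom P) = p.eval (xCoord P) / q.eval (xCoord P) ∧
        etaCoord (φ.toHom P) = 1 / l * etaCoord P *
          ((derivative p * q - p * derivative q).eval (xCoord P) / q.eval (xCoord P) ^ 2) := by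
      filter_upwards [h] with P ⟨x, y, hxy, x', y', hxy', hP, hφP, hq, hx, hy⟩
      rw [hφP, hP]
      exact ⟨Affine.Point.some_ne_zero _, hq, hx, hy⟩
    have hq : q ≠ 0 := by
      obtain ⟨P, -, hP, -⟩ := h'.exists
      rintro rfl
      simp at hP
    refine ⟨algebraMap F[X] (RatFunc F) p / algebraMap F[X] (RatFunc F) q,
      h'.mono fun P h => h.1, ?_, ?_⟩
    · rw [evalGerm_div W₁ _ hq, Germ.coe_eq]
      exact h'.mono fun P h => h.2.2.1
    · rw [ratDeriv_div, ← map_pow, map_mul, evalGerm_C, evalGerm_div W₁ _ (pow_ne_zero 2 hq),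
        etaGerm, ← Germ.coe_mul, ← Germ.coe_mul, Germ.coe_eq]
      filter_upwards [h'] with P ⟨_, _, _, h4⟩
      rw [h4]
      simp only [Pi.mul_apply, eval_pow]
      ring
  · rintro ⟨f, h⟩
    have hq := f.denom_ne_zero
    have hx := h.x_eq
    have hη := h.eta_eq
    rw [← f.num_div_denom, evalGerm_div W₁ _ hq, Germ.coe_eq] at hx
    rw [← f.num_div_denom, ratDeriv_div, ← map_pow, map_mul, evalGerm_C,
      evalGerm_div W₁ _ (pow_ne_zero 2 hq), etaGerm, ← Germ.coe_mul, ← Germ.coe_mul,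
      Germ.coe_eq] at hη
    refine ⟨f.num, f.denom, ?_⟩
    filter_upwards [hx, hη, h.ne_zero, eventually_ne_zero, eventually_eval_ne_zero hq]
      with P hx hη hφP hP hqP
    obtain ⟨x, y, hxy, rfl⟩ := exists_some_of_ne_zero hP
    obtain ⟨x', y', hxy', hφ⟩ := exists_some_of_ne_zero hφP
    rw [hφ] at hx hη
    simp only [xCoord_some, etaCoord_some, Pi.mul_apply, eval_pow] at hx hη hqP
    refine ⟨x, y, hxy, x', y', hxy', rfl, hφ, hqP, hx, ?_⟩
    rw [hη]
    ring

theorem Isogeny.exists_hasFactor [CharZero F] [Infinite W₁.toAffine.Point]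
    [Infinite W₂.toAffine.Point] (φ : Isogeny W₁ W₂) : ∃ l, φ.HasFactor l := by
  obtain ⟨f, g, h⟩ := φ.rational.exists_hasForm
  obtain ⟨l, hl, rfl⟩ := h.exists_ratDeriv_eq
  exact ⟨l, (hasFactor_iff φ l).mpr ⟨hl, f, h⟩⟩

theorem Isogeny.HasFactor.unique_of_toHom_eq [CharZero F] [Infinite W₁.toAffine.Point]
    {φ φ' : Isogeny W₁ W₂} {l l' : F} (h : φ.HasFactor l) (h' : φ'.HasFactor l')
    (heq : φ.toHom = φ'.toHom) : l = l' := by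
  obtain ⟨hl, f, h⟩ := (hasFactor_iff φ l).mp h
  obtain ⟨hl', f', h'⟩ := (hasFactor_iff φ' l').mp h'
  rw [heq] at h
  obtain ⟨rfl, hg⟩ := h.unique h'
  have := mul_right_cancel₀ h.ratDeriv_ne_zero hg
  have := RatFunc.C_injective this
  simpa using this

/-- The composition of isogenies. -/
noncomputable def Isogeny.comp [CharZero F] [Infinite W₁.toAffine.Point]
    [Infinite W₂.toAffine.Point] (ψ : Isogeny W₂ W₃) (φ : Isogeny W₁ W₂) : Isogeny W₁ W₃ where
  toHom := ψ.toHom.comp φ.toHom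
  rational := by
    obtain ⟨f, g, h⟩ := φ.rational.exists_hasForm
    obtain ⟨f', g', h'⟩ := ψ.rational.exists_hasForm
    exact (h'.comp h).isRationalOver_self

/-- The chain rule, together with the composition law for forms. -/
theorem Isogeny.HasFactor.comp [CharZero F] [Infinite W₁.toAffine.Point]
    [Infinite W₂.toAffine.Point] {ψ : Isogeny W₂ W₃} {φ : Isogeny W₁ W₂} {l m : F}
    (h' : ψ.HasFactor m) (h : φ.HasFactor l) : (ψ.comp φ).HasFactor (m * l) := by
  rw [hasFactor_iff] at h h' ⊢
  obtain ⟨hl, f, h⟩ := h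
  obtain ⟨hm, f', h'⟩ := h'
  refine ⟨mul_ne_zero hm hl, h.subst f', ?_⟩
  have := h'.comp h
  rw [map_mul, ratAlgHom_C] at this
  convert this using 1
  · rfl
  rw [ratDeriv_algHom, h.subst_X, ← one_div_mul_one_div_rev, map_mul]
  ring

end StandardForm

/-! ### An isogeny is determined by its factor -/

section Uniqueness

open Polynomial Filter

/-- Any P is the difference of two points P + T and T outside the finite exceptional set. -/
theorem addMonoidHom_eq_zero_of_eventually {A B : Type*} [AddGroup A] [Infinite A] [AddGroup B]
    {δ : A →+ B} (h : ∀ᶠ P in cofinite, δ P = 0) : δ = 0 := by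
  ext P
  obtain ⟨T, h1, h2⟩ := (h.and (((add_right_injective P).tendsto_cofinite).eventually h)).exists
  rw [map_add, h1, add_zero] at h2
  exact h2

variable {F : Type*} [Field F] {W₁ W₂ : WeierstrassCurve F}

theorem eventually_ne_zero_of_evalGerm [Infinite W₁.toAffine.Point] {r : RatFunc F}
    {u : W₁.toAffine.Point → F} (hr : r ≠ 0) (h : (u : PtGerm W₁) = evalGerm W₁ r) :
    ∀ᶠ P in cofinite, u P ≠ 0 := by
  obtain ⟨v, hv⟩ := Quotient.exists_rep (evalGerm W₁ r⁻¹)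
  have : (u : PtGerm W₁) * (v : PtGerm W₁) = 1 := by
    rw [h, show (v : PtGerm W₁) = _ from hv, ← map_mul, mul_inv_cancel₀ hr, map_one]
  rw [← Germ.coe_mul, ← Germ.coe_one, Germ.coe_eq] at this
  filter_upwards [this] with P hP h0
  simp [h0] at hP

/-- The derivative of the equation of the second curve along a map that multiplies the invariant
differential by a constant. -/
theorem deriv_equation {f g : RatFunc F} {l : F} (hD : ratDeriv f = RatFunc.C l * g) (hg : g ≠ 0)
    (h : g ^ 2 * algebraMap F[X] (RatFunc F) W₁.Ψ₂Sq = aeval f W₂.Ψ₂Sq) :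
    2 * ratDeriv g * algebraMap F[X] (RatFunc F) W₁.Ψ₂Sq +
      g * ratDeriv (algebraMap F[X] (RatFunc F) W₁.Ψ₂Sq) =
        RatFunc.C l * aeval f (derivative W₂.Ψ₂Sq) := by
  have h1 := congrArg ratDeriv h
  rw [Derivation.map_aeval, Derivation.leibniz, Derivation.leibniz_pow, hD] at h1
  simp only [smul_eq_mul, nsmul_eq_mul] at h1
  apply mul_left_cancel₀ hg
  norm_num at h1
  linear_combination h1

variable [CharZero F]

/-- The difference of two maps with the same effect on the invariant differential has constant
`x`-coordinate. -/
theorem ratDeriv_sub_form {f₁ f₂ g₁ g₂ f₃ : RatFunc F} {l : F}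
    (hD₁ : ratDeriv f₁ = RatFunc.C l * g₁) (hD₂ : ratDeriv f₂ = RatFunc.C l * g₂)
    (hg₁ : g₁ ≠ 0) (hg₂ : g₂ ≠ 0)
    (h₁ : g₁ ^ 2 * algebraMap F[X] (RatFunc F) W₁.Ψ₂Sq = aeval f₁ W₂.Ψ₂Sq)
    (h₂ : g₂ ^ 2 * algebraMap F[X] (RatFunc F) W₁.Ψ₂Sq = aeval f₂ W₂.Ψ₂Sq)
    (hne : f₁ - f₂ ≠ 0)
    (h₃ : 4 * (f₁ - f₂) ^ 2 * (f₃ + RatFunc.C (W₂.b₂ / 4) + f₁ + f₂) =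
      (g₁ + g₂) ^ 2 * algebraMap F[X] (RatFunc F) W₁.Ψ₂Sq) :
    ratDeriv f₃ = 0 := by
  have e₁ := deriv_equation hD₁ hg₁ h₁
  have e₂ := deriv_equation hD₂ hg₂ h₂
  have e₃ := congrArg ratDeriv h₃
  have hC4 : ratDeriv (4 : RatFunc F) = 0 := by
    rw [show (4 : RatFunc F) = RatFunc.C 4 by rw [map_ofNat], ratDeriv_C]
  have hb₂ : RatFunc.C (W₂.b₂ / 4) = RatFunc.C W₂.b₂ / 4 := by
    rw [map_div₀, map_ofNat]
  have hΨ (f : RatFunc F) : aeval f W₂.Ψ₂Sq = 4 * f ^ 3 + RatFunc.C W₂.b₂ * f ^ 2 +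
      2 * RatFunc.C W₂.b₄ * f + RatFunc.C W₂.b₆ := by
    simp only [Ψ₂Sq, map_add, map_mul, aeval_C, RatFunc.algebraMap_eq_C, map_pow, aeval_X,
      map_ofNat]
  have hΨ' (f : RatFunc F) : aeval f (derivative W₂.Ψ₂Sq) = 12 * f ^ 2 +
      2 * RatFunc.C W₂.b₂ * f + 2 * RatFunc.C W₂.b₄ := by
    have : derivative W₂.Ψ₂Sq = C 12 * X ^ 2 + C (2 * W₂.b₂) * X + C (2 * W₂.b₄) := by
      simp only [Ψ₂Sq, derivative_add, derivative_C_mul, derivative_X_pow, derivative_C,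
        map_mul, map_ofNat]
      norm_num
      rw [show (C 3 : F[X]) = 3 from map_ofNat C 3, show (C 2 : F[X]) = 2 from map_ofNat C 2]
      ring
    simp only [this, map_add, map_mul, aeval_C, RatFunc.algebraMap_eq_C, map_pow, aeval_X,
      map_ofNat]
  rw [hΨ] at h₁ h₂
  rw [hΨ'] at e₁ e₂
  simp only [Derivation.leibniz, Derivation.leibniz_pow, map_add, smul_eq_mul,
    nsmul_eq_mul, map_sub, hD₁, hD₂, ratDeriv_C, hC4] at e₃
  rw [hb₂] at h₃ e₃
  norm_num at e₃
  generalize algebraMap F[X] (RatFunc F) W₁.Ψ₂Sq = S at *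
  have hB : 4 * (f₁ - f₂) ^ 3 ≠ 0 := by
    refine mul_ne_zero ?_ (pow_ne_zero 3 hne)
    rw [← map_ofNat (RatFunc.C (K := F)), ne_eq, map_eq_zero]
    norm_num
  apply mul_left_cancel₀ hB
  -- The derivative of the right side of `h₃` is g₁ + g₂ times the sum of the left sides of `e₁` and
  -- `e₂`. Then `h₃` removes the undifferentiated f₃, and `h₁ - h₂` removes (g₁² − g₂²)S.
  linear_combination (f₁ - f₂) * e₃ + (f₁ - f₂) * (g₁ + g₂) * (e₁ + e₂) -
    2 * RatFunc.C l * (g₁ - g₂) * h₃ - 2 * RatFunc.C l * (g₁ + g₂) * (h₁ - h₂)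

variable [DecidableEq F]

/-- Two homomorphisms with the same effect on the invariant differential are equal. -/
theorem HasForm.eq_of_ratDeriv_eq [Infinite W₁.toAffine.Point]
    {φ₁ φ₂ : W₁.toAffine.Point →+ W₂.toAffine.Point} {f₁ f₂ g₁ g₂ : RatFunc F} {l : F} (hl : l ≠ 0)
    (h₁ : HasForm φ₁ f₁ g₁) (h₂ : HasForm φ₂ f₂ g₂)
    (hD₁ : ratDeriv f₁ = RatFunc.C l * g₁) (hD₂ : ratDeriv f₂ = RatFunc.C l * g₂) :
    φ₁ = φ₂ := by
  rw [← sub_eq_zero]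
  by_cases hf : f₁ = f₂
  · subst hf
    have hg : g₁ = g₂ := by
      rw [hD₁] at hD₂
      exact mul_left_cancel₀ (by simpa using hl) hD₂
    subst hg
    have hx := h₁.x_eq.trans h₂.x_eq.symm
    have hη := h₁.eta_eq.trans h₂.eta_eq.symm
    rw [Germ.coe_eq] at hx hη
    apply addMonoidHom_eq_zero_of_eventually
    filter_upwards [hx, hη, h₁.ne_zero, h₂.ne_zero] with P hx hη hP₁ hP₂
    rw [AddMonoidHom.sub_apply, sub_eq_zero]
    exact eq_of_coord_eq hP₁ hP₂ hx hη
  · exfalso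
    have hne : f₁ - f₂ ≠ 0 := sub_ne_zero.mpr hf
    set S := algebraMap F[X] (RatFunc F) W₁.Ψ₂Sq with hS
    -- The x-coordinate of φ₁ − φ₂ as predicted by the subtraction formula; it turns out to be a
    -- constant c.
    set f₃ : RatFunc F := (g₁ + g₂) ^ 2 * S / (4 * (f₁ - f₂) ^ 2) - RatFunc.C (W₂.b₂ / 4) - f₁ - f₂
      with hf₃
    have h₃ : 4 * (f₁ - f₂) ^ 2 * (f₃ + RatFunc.C (W₂.b₂ / 4) + f₁ + f₂) = (g₁ + g₂) ^ 2 * S := by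
      rw [hf₃]
      field_simp
      ring
    obtain ⟨c, hc⟩ := exists_C_of_ratDeriv_eq_zero
      (ratDeriv_sub_form hD₁ hD₂ h₁.g_ne_zero h₂.g_ne_zero h₁.sq_mul h₂.sq_mul hne h₃)
    have hxne : ∀ᶠ P in cofinite, xCoord (φ₁ P) - xCoord (φ₂ P) ≠ 0 := by
      refine eventually_ne_zero_of_evalGerm hne ?_
      rw [map_sub, ← h₁.x_eq, ← h₂.x_eq, ← Germ.coe_sub]
      rfl
    have hgerm := congrArg (evalGerm W₁) h₃
    rw [hc] at hgerm
    simp only [map_mul, map_pow, map_add, map_sub, map_ofNat, ← h₁.x_eq, ← h₂.x_eq, evalGerm_C, hS,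
      ← etaGerm_sq] at hgerm
    rw [← mul_pow, add_mul, mul_comm _ (etaGerm W₁), mul_comm _ (etaGerm W₁), ← h₁.eta_eq,
      ← h₂.eta_eq] at hgerm
    have h4 : (4 : PtGerm W₁) = ((fun _ => 4 : W₁.toAffine.Point → F) : PtGerm W₁) := by
      rw [← map_ofNat (evalGerm W₁), ← map_ofNat (RatFunc.C (K := F)), evalGerm_C]
    rw [h4] at hgerm
    simp only [← Germ.coe_mul, ← Germ.coe_sub, ← Germ.coe_pow, ← Germ.coe_add] at hgerm
    rw [Germ.coe_eq] at hgerm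
    have hδ : ∀ᶠ P in cofinite, (φ₁ - φ₂) P ≠ 0 ∧ xCoord ((φ₁ - φ₂) P) = c := by
      filter_upwards [hgerm, hxne, h₁.ne_zero, h₂.ne_zero] with P hg hx hP₁ hP₂
      rw [AddMonoidHom.sub_apply]
      refine ⟨fun h => hx ?_, ?_⟩
      · rw [sub_eq_zero.mp h, sub_self]
      rw [xCoord_sub hP₁ hP₂ (sub_ne_zero.mp hx)]
      simp only [Pi.mul_apply, Pi.sub_apply, Pi.pow_apply, Pi.add_apply] at hg
      rw [← hg]
      field_simp
      ring
    -- The difference φ₁ − φ₂ has finite kernel, hence finite fibres, so its x-coordinate cannot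
    -- equal c at almost all of infinitely many points.
    have ht := tendsto_xCoord.comp
      (tendsto_cofinite_of_eventually_ne_zero (hδ.mono fun P h => h.1))
    obtain ⟨P, hP, hP'⟩ := (hδ.and (ht.eventually
      (Set.finite_singleton c).eventually_cofinite_notMem)).exists
    exact hP' hP.2

/-- This converts Galois invariance of the number l into Galois invariance of the isogeny. -/
theorem Isogeny.HasFactor.toHom_eq [Infinite W₁.toAffine.Point] {φ₁ φ₂ : Isogeny W₁ W₂} {l : F}
    (h₁ : φ₁.HasFactor l) (h₂ : φ₂.HasFactor l) : φ₁.toHom = φ₂.toHom := by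
  rw [hasFactor_iff] at h₁ h₂
  obtain ⟨hl, f₁, h₁⟩ := h₁
  obtain ⟨-, f₂, h₂⟩ := h₂
  have (f : RatFunc F) : ratDeriv f = RatFunc.C l * (RatFunc.C (1 / l) * ratDeriv f) := by
    rw [← mul_assoc, ← map_mul, mul_one_div_cancel hl, map_one, one_mul]
  exact h₁.eq_of_ratDeriv_eq hl h₂ (this f₁) (this f₂)

end Uniqueness

/-! ### Conjugating curves, homomorphisms and isogenies by a field automorphism -/

section Conjugation

open Polynomial Filter

variable {F : Type*} [Field F] [DecidableEq F]

theorem exists_pointHom {F' : Type*} [Field F'] [DecidableEq F'] (τ : F →+* F')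
    (W : WeierstrassCurve F) :
    ∃ e : W.toAffine.Point →+ (W.map τ).toAffine.Point, ∀ x y (h : W.toAffine.Nonsingular x y),
      ∃ h', e (.some x y h) = .some (τ x) (τ y) h' := by
  let := τ.toAlgebra
  exact ⟨Affine.Point.map (W' := W.toAffine) (Algebra.ofId F F'),
    fun x y h => ⟨_, Affine.Point.map_some (W' := W.toAffine) (Algebra.ofId F F') h⟩⟩

theorem exists_pointEquiv (τ : F ≃+* F) (W : WeierstrassCurve F) :
    ∃ e : W.toAffine.Point ≃+ (W.map (τ : F →+* F)).toAffine.Point,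
      ∀ x y (h : W.toAffine.Nonsingular x y), ∃ h', e (.some x y h) = .some (τ x) (τ y) h' := by
  obtain ⟨e, he⟩ := exists_pointHom (τ : F →+* F) W
  refine ⟨AddEquiv.ofBijective e ⟨?_, ?_⟩, he⟩
  · rw [injective_iff_map_eq_zero]
    intro P hP
    by_contra h0
    obtain ⟨x, y, h, rfl⟩ := exists_some_of_ne_zero h0
    obtain ⟨h', h2⟩ := he x y h
    rw [h2] at hP
    exact Affine.Point.some_ne_zero _ hP
  · intro P
    by_cases hP : P = 0
    · exact ⟨0, by rw [hP, map_zero]⟩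
    obtain ⟨x, y, h, rfl⟩ := exists_some_of_ne_zero hP
    have h' : W.toAffine.Nonsingular (τ.symm x) (τ.symm y) := by
      rw [← Affine.map_nonsingular (f := (τ : F →+* F)) W.toAffine τ.injective]
      simpa using h
    obtain ⟨h2, h3⟩ := he _ _ h'
    exact ⟨_, h3.trans (by simp)⟩

/-- The bijection between the points of a curve and those of a conjugate curve. -/
noncomputable def pointConj (τ : F ≃+* F) {W W' : WeierstrassCurve F}
    (h : W' = W.map (τ : F →+* F)) : W.toAffine.Point ≃+ W'.toAffine.Point :=
  (exists_pointEquiv τ W).choose.trans (by subst h; exact AddEquiv.refl _)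

variable {τ : F ≃+* F} {W W' : WeierstrassCurve F}

theorem pointConj_some (h : W' = W.map (τ : F →+* F)) {x y : F}
    (hxy : W.toAffine.Nonsingular x y) :
    ∃ h', pointConj τ h (.some x y hxy) = .some (τ x) (τ y) h' := by
  subst h
  exact (exists_pointEquiv τ W).choose_spec x y hxy

theorem xCoord_pointConj (h : W' = W.map (τ : F →+* F)) {P : W.toAffine.Point} (hP : P ≠ 0) :
    xCoord (pointConj τ h P) = τ (xCoord P) := by
  obtain ⟨x, y, hxy, rfl⟩ := exists_some_of_ne_zero hP
  obtain ⟨h', h2⟩ := pointConj_some h hxy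
  rw [h2]
  rfl

theorem etaCoord_pointConj (h : W' = W.map (τ : F →+* F)) {P : W.toAffine.Point} (hP : P ≠ 0) :
    etaCoord (pointConj τ h P) = τ (etaCoord P) := by
  obtain ⟨x, y, hxy, rfl⟩ := exists_some_of_ne_zero hP
  obtain ⟨h', h2⟩ := pointConj_some h hxy
  rw [h2, etaCoord_some, etaCoord_some, h, map_add, map_add, map_mul, map_mul, map_ofNat]
  rfl

variable {W₁ W₂ W₁' W₂' : WeierstrassCurve F}

/-- The conjugate of a homomorphism. -/
noncomputable def homConj (h₁ : W₁' = W₁.map (τ : F →+* F)) (h₂ : W₂' = W₂.map (τ : F →+* F))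
    (φ : W₁.toAffine.Point →+ W₂.toAffine.Point) : W₁'.toAffine.Point →+ W₂'.toAffine.Point :=
  (pointConj τ h₂ : W₂.toAffine.Point →+ W₂'.toAffine.Point).comp
    (φ.comp ((pointConj τ h₁).symm : W₁'.toAffine.Point →+ W₁.toAffine.Point))

theorem homConj_pointConj (h₁ : W₁' = W₁.map (τ : F →+* F)) (h₂ : W₂' = W₂.map (τ : F →+* F))
    (φ : W₁.toAffine.Point →+ W₂.toAffine.Point) (P : W₁.toAffine.Point) :
    homConj h₁ h₂ φ (pointConj τ h₁ P) = pointConj τ h₂ (φ P) := by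
  simp [homConj]

/-- The bijection of points applies τ to x and η, so evaluating a polynomial at the conjugate point
amounts to moving its coefficients by τ. -/
theorem HasForm.conj {φ : W₁.toAffine.Point →+ W₂.toAffine.Point} {p q r s : F[X]}
    (hq : q ≠ 0) (hs : s ≠ 0)
    (h : HasForm φ (algebraMap F[X] (RatFunc F) p / algebraMap F[X] (RatFunc F) q)
      (algebraMap F[X] (RatFunc F) r / algebraMap F[X] (RatFunc F) s))
    (h₁ : W₁' = W₁.map (τ : F →+* F)) (h₂ : W₂' = W₂.map (τ : F →+* F)) :
    HasForm (homConj h₁ h₂ φ)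
      (algebraMap F[X] (RatFunc F) (p.map (τ : F →+* F)) /
        algebraMap F[X] (RatFunc F) (q.map (τ : F →+* F)))
      (algebraMap F[X] (RatFunc F) (r.map (τ : F →+* F)) /
        algebraMap F[X] (RatFunc F) (s.map (τ : F →+* F))) := by
  have lift {Q : W₁'.toAffine.Point → Prop} (hQ : ∀ᶠ P in cofinite, Q (pointConj τ h₁ P)) :
      ∀ᶠ P in cofinite, Q P := by
    have := (pointConj τ h₁).symm.injective.tendsto_cofinite.eventually hQ
    simpa using this
  have hx := h.x_eq
  have hη := h.eta_eq
  rw [evalGerm_div _ _ hq, Germ.coe_eq] at hx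
  rw [evalGerm_div _ _ hs, etaGerm, ← Germ.coe_mul, Germ.coe_eq] at hη
  have hev (t : F[X]) (x : F) : (t.map (τ : F →+* F)).eval (τ x) = τ (t.eval x) :=
    eval_map_apply (τ : F →+* F) x
  refine ⟨lift ?_, ?_, ?_⟩
  · filter_upwards [h.ne_zero] with P hP
    rwa [homConj_pointConj, ne_eq, EmbeddingLike.map_eq_zero_iff]
  · rw [evalGerm_div _ _ (Polynomial.map_ne_zero hq), Germ.coe_eq]
    refine lift ?_
    filter_upwards [h.ne_zero, hx, eventually_ne_zero] with P hφP hx hP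
    rw [homConj_pointConj, xCoord_pointConj h₂ hφP, hx, xCoord_pointConj h₁ hP, hev, hev, map_div₀]
  · rw [evalGerm_div _ _ (Polynomial.map_ne_zero hs), etaGerm, ← Germ.coe_mul, Germ.coe_eq]
    refine lift ?_
    filter_upwards [h.ne_zero, hη, eventually_ne_zero] with P hφP hη hP
    rw [homConj_pointConj, etaCoord_pointConj h₂ hφP, hη, Pi.mul_apply, Pi.mul_apply,
      xCoord_pointConj h₁ hP, hev, hev, map_mul, map_div₀, etaCoord_pointConj h₁ hP]

variable [Infinite W₁.toAffine.Point]

theorem infinite_point_of_map (h₁ : W₁' = W₁.map (τ : F →+* F)) :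
    Infinite W₁'.toAffine.Point :=
  Infinite.of_injective _ (pointConj τ h₁).injective

variable [CharZero F]

/-- The conjugate of an isogeny. -/
noncomputable def Isogeny.conj (φ : Isogeny W₁ W₂) (τ : F ≃+* F)
    (h₁ : W₁' = W₁.map (τ : F →+* F)) (h₂ : W₂' = W₂.map (τ : F →+* F)) : Isogeny W₁' W₂' where
  toHom := homConj h₁ h₂ φ.toHom
  rational := by
    obtain ⟨f, g, h⟩ := φ.rational.exists_hasForm
    rw [← f.num_div_denom, ← g.num_div_denom] at h
    exact (h.conj f.denom_ne_zero g.denom_ne_zero h₁ h₂).isRationalOver_self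

/-- Formal differentiation commutes with applying τ to coefficients, so the relation g = f'/l is
carried to the same relation with τ(l). -/
theorem Isogeny.HasFactor.conj {φ : Isogeny W₁ W₂} {l : F} (h : φ.HasFactor l)
    (h₁ : W₁' = W₁.map (τ : F →+* F)) (h₂ : W₂' = W₂.map (τ : F →+* F)) :
    (φ.conj τ h₁ h₂).HasFactor (τ l) := by
  have := infinite_point_of_map h₁
  rw [hasFactor_iff] at h ⊢
  obtain ⟨hl, f, h⟩ := h
  refine ⟨by simpa using hl, algebraMap F[X] (RatFunc F) (f.num.map (τ : F →+* F)) /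
    algebraMap F[X] (RatFunc F) (f.denom.map (τ : F →+* F)), ?_⟩
  have hform (c : F) (p q : F[X]) : RatFunc.C c * ratDeriv (algebraMap F[X] (RatFunc F) p /
      algebraMap F[X] (RatFunc F) q) =
        algebraMap F[X] (RatFunc F) (C c * (derivative p * q - p * derivative q)) /
          algebraMap F[X] (RatFunc F) (q ^ 2) := by
    rw [ratDeriv_div, map_mul, RatFunc.algebraMap_C, map_pow, mul_div_assoc]
  rw [← f.num_div_denom, hform] at h
  have := h.conj f.denom_ne_zero (pow_ne_zero 2 f.denom_ne_zero) h₁ h₂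
  have hmap : (C (1 / l) * (derivative f.num * f.denom - f.num * derivative f.denom)).map
      (τ : F →+* F) = C (1 / τ l) * (derivative (f.num.map (τ : F →+* F)) *
        f.denom.map (τ : F →+* F) - f.num.map (τ : F →+* F) *
          derivative (f.denom.map (τ : F →+* F))) := by
    simp [Polynomial.derivative_map]
  rw [hmap, Polynomial.map_pow, ← hform] at this
  exact this

end Conjugation

/-! ### Descent of the field of definition -/

section Descent

open Polynomial Filter

variable {k F : Type*} [Field k] [Field F] [Algebra k F]

theorem exists_map_eq_of_forall_map_eq
    (hfix : ∀ x : F, (∀ τ : F ≃ₐ[k] F, τ x = x) → x ∈ Set.range (algebraMap k F))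
    {p : F[X]} (hp : ∀ τ : F ≃ₐ[k] F, p.map (τ : F →+* F) = p) :
    ∃ p₀ : k[X], p₀.map (algebraMap k F) = p := by
  rw [← Polynomial.mem_lifts, Polynomial.lifts_iff_coeff_lifts]
  refine fun n => hfix _ fun τ => ?_
  nth_rewrite 2 [← hp τ]
  rw [coeff_map]
  rfl

/-- A fraction in lowest terms with monic denominator is unique, so if τ fixes the fraction it fixes
numerator and denominator separately. -/
theorem num_denom_map_eq {τ : F →+* F} {f : RatFunc F}
    (h : algebraMap F[X] (RatFunc F) (f.num.map τ) / algebraMap F[X] (RatFunc F) (f.denom.map τ) =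
      f) : f.num.map τ = f.num ∧ f.denom.map τ = f.denom := by
  have hq := f.denom_ne_zero
  have hq' : f.denom.map τ ≠ 0 := Polynomial.map_ne_zero hq
  nth_rewrite 3 [← f.num_div_denom] at h
  rw [div_eq_div_iff (RatFunc.algebraMap_ne_zero hq') (RatFunc.algebraMap_ne_zero hq), ← map_mul,
    ← map_mul, (RatFunc.algebraMap_injective F).eq_iff] at h
  have hcop := f.isCoprime_num_denom
  have hcop' : IsCoprime (f.num.map τ) (f.denom.map τ) := hcop.map (mapRingHom τ)
  have hd : f.denom ∣ f.denom.map τ := hcop.symm.dvd_of_dvd_mul_left (Dvd.intro_left _ h)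
  have hd' : f.denom.map τ ∣ f.denom := hcop'.symm.dvd_of_dvd_mul_left (Dvd.intro_left _ h.symm)
  have heq : f.denom.map τ = f.denom :=
    eq_of_monic_of_associated (f.monic_denom.map τ) f.monic_denom (associated_of_dvd_dvd hd' hd)
  rw [heq] at h
  exact ⟨mul_right_cancel₀ hq h, heq⟩

/-- Galois descent for isogenies. -/
theorem Isogeny.isDefinedOver_of_conj_eq [DecidableEq F] [CharZero F] {W₁ W₂ : WeierstrassCurve k}
    [Infinite (W₁.map (algebraMap k F)).toAffine.Point]
    (hfix : ∀ x : F, (∀ τ : F ≃ₐ[k] F, τ x = x) → x ∈ Set.range (algebraMap k F))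
    (φ : Isogeny (W₁.map (algebraMap k F)) (W₂.map (algebraMap k F)))
    (h : ∀ (τ : F ≃ₐ[k] F)
      (h₁ : W₁.map (algebraMap k F) = (W₁.map (algebraMap k F)).map ((τ : F ≃+* F) : F →+* F))
      (h₂ : W₂.map (algebraMap k F) = (W₂.map (algebraMap k F)).map ((τ : F ≃+* F) : F →+* F)),
      (φ.conj (τ : F ≃+* F) h₁ h₂).toHom = φ.toHom) :
    φ.IsDefinedOver k := by
  have hmap (W : WeierstrassCurve k) (τ : F ≃ₐ[k] F) :
      W.map (algebraMap k F) = (W.map (algebraMap k F)).map ((τ : F ≃+* F) : F →+* F) := by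
    rw [WeierstrassCurve.map_map]
    congr 1
    ext x
    simp
  obtain ⟨f, g, hf⟩ := φ.rational.exists_hasForm
  have hf' := hf
  rw [← f.num_div_denom, ← g.num_div_denom] at hf'
  have key (τ : F ≃ₐ[k] F) := by
    have h1 := hf'.conj f.denom_ne_zero g.denom_ne_zero (hmap W₁ τ) (hmap W₂ τ)
    have h2 := h τ (hmap W₁ τ) (hmap W₂ τ)
    change homConj _ _ φ.toHom = _ at h2
    rw [h2] at h1
    exact h1.unique hf
  obtain ⟨p, hp⟩ := exists_map_eq_of_forall_map_eq hfix fun τ => (num_denom_map_eq (key τ).1).1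
  obtain ⟨q, hq⟩ := exists_map_eq_of_forall_map_eq hfix fun τ => (num_denom_map_eq (key τ).1).2
  obtain ⟨r, hr⟩ := exists_map_eq_of_forall_map_eq hfix fun τ => (num_denom_map_eq (key τ).2).1
  obtain ⟨s, hs⟩ := exists_map_eq_of_forall_map_eq hfix fun τ => (num_denom_map_eq (key τ).2).2
  rw [← hp, ← hq, ← hr, ← hs] at hf'
  refine hf'.isRationalOver (b₁ := W₁.a₁) (b₃ := W₁.a₃) (c₁ := W₂.a₁) (c₃ := W₂.a₃) ?_ ?_
    rfl rfl rfl rfl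
  · rintro rfl
    exact f.denom_ne_zero (by rw [← hq, Polynomial.map_zero])
  · rintro rfl
    exact g.denom_ne_zero (by rw [← hs, Polynomial.map_zero])

end Descent

/-! ### Galois theory of K(x) over k -/

section Klein

open IntermediateField

theorem isKleinFour_of_card_of_sq {G : Type*} [Group G] (hcard : Nat.card G = 4)
    (hsq : ∀ g : G, g * g = 1) : IsKleinFour G where
  card_four := hcard
  exponent_two := by
    have h : Monoid.exponent G ∣ 2 :=
      Monoid.exponent_dvd_of_forall_pow_eq_one fun g => by rw [pow_two, hsq]
    rcases (Nat.dvd_prime Nat.prime_two).mp h with h | h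
    · rw [Monoid.exp_eq_one_iff] at h
      rw [Nat.card_of_subsingleton (1 : G)] at hcard
      omega
    · exact h

instance : IsKleinFour (Multiplicative (ZMod 2) × Multiplicative (ZMod 2)) :=
  isKleinFour_of_card_of_sq (by simp) (by decide)

variable {k F : Type*} [Field k] [LinearOrder k] [IsStrictOrderedRing k] [Field F] [Algebra k F]

/-- All τⁿ(x) = rⁿx are roots of the minimal polynomial of x. Unless |r| = 1 they would be
infinitely many; the order on k leaves r = ±1. -/
theorem eq_or_eq_neg_of_apply_eq_smul [Algebra.IsAlgebraic k F] {x : F} (hx : x ≠ 0)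
    (τ : Gal(F/k)) {r : k} (h : τ x = algebraMap k F r * x) : τ x = x ∨ τ x = -x := by
  have hpow (n : ℕ) : (τ ^ n) x = algebraMap k F (r ^ n) * x := by
    induction n with
    | zero => simp
    | succ n ih =>
      rw [pow_succ', AlgEquiv.mul_apply, ih, map_mul, AlgEquiv.commutes, h, pow_succ, map_mul]
      ring
  have hr : r ≠ 0 := by
    rintro rfl
    rw [map_zero, zero_mul, EmbeddingLike.map_eq_zero_iff] at h
    exact hx h
  have habs : |r| = 1 := by
    by_contra hne
    have hinj : Function.Injective fun n : ℕ => (τ ^ n) x := by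
      intro m n hmn
      simp only [hpow] at hmn
      have h1 := (algebraMap k F).injective (mul_right_cancel₀ hx hmn)
      have h2 := congrArg abs h1
      rw [abs_pow, abs_pow] at h2
      exact pow_right_injective₀ (abs_pos.mpr hr) hne h2
    refine Set.infinite_range_of_injective hinj
      (((minpoly k x).rootSet_finite F).subset ?_)
    rintro _ ⟨n, rfl⟩
    have hint : IsIntegral k x := Algebra.IsIntegral.isIntegral x
    rw [Polynomial.mem_rootSet]
    refine ⟨minpoly.ne_zero hint, ?_⟩
    have := Polynomial.aeval_algHom_apply ((τ ^ n : Gal(F/k)) : F →ₐ[k] F) x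
      (minpoly k x)
    rw [minpoly.aeval, map_zero] at this
    exact this
  rcases eq_or_eq_neg_of_abs_eq habs with rfl | rfl
  · left; simpa using h
  · right; simpa using h

/-- The Galois group of `K(x)` over `k` for a quadratic extension `K` of `k` and an element `x` such
that `τ x` is a `k`-multiple of `x` or of `x⁻¹`, for `τ` trivial or nontrivial on `K`. -/
theorem isGalois_and_isKleinFour [IsGalois k F] {K L : IntermediateField k F}
    (hK : Module.finrank k K = 2) {x : F} (hx : x ∉ K)
    (h₁ : ∀ τ : Gal(F/k), (∀ a ∈ K, τ a = a) → ∃ r : k, τ x = algebraMap k F r * x)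
    (h₂ : ∀ τ : Gal(F/k), (¬ ∀ a ∈ K, τ a = a) → ∃ r : k, x * τ x = algebraMap k F r)
    (hL : L = K ⊔ IntermediateField.adjoin k {x}) :
    IsGalois k L ∧ IsKleinFour Gal(L/k) := by
  have : Algebra.IsQuadraticExtension k K := ⟨hK⟩
  have hx0 : x ≠ 0 := fun h => hx (h ▸ K.zero_mem)
  have hKL : K ≤ L := hL ▸ le_sup_left
  have hxL : x ∈ L := by
    rw [hL]
    exact (le_sup_right : _ ≤ K ⊔ IntermediateField.adjoin k {x})
      (IntermediateField.mem_adjoin_simple_self k x)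
  have hpm (τ : Gal(F/k)) (hτ : ∀ a ∈ K, τ a = a) : τ x = x ∨ τ x = -x := by
    obtain ⟨r, hr⟩ := h₁ τ hτ
    exact eq_or_eq_neg_of_apply_eq_smul hx0 τ hr
  have hτL (τ : Gal(F/k)) : τ x ∈ L := by
    by_cases hτ : ∀ a ∈ K, τ a = a
    · rcases hpm τ hτ with h | h <;> rw [h]
      · exact hxL
      · exact L.neg_mem hxL
    · obtain ⟨r, hr⟩ := h₂ τ hτ
      rw [eq_div_of_mul_eq hx0 ((mul_comm _ _).trans hr)]
      exact L.div_mem (L.algebraMap_mem r) hxL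
  have hnormal : Normal k L := by
    rw [IntermediateField.normal_iff_forall_map_le']
    intro τ
    rw [hL, IntermediateField.map_sup, sup_le_iff, ← hL]
    refine ⟨((IntermediateField.normal_iff_forall_map_le'.mp inferInstance) τ).trans hKL, ?_⟩
    rw [IntermediateField.adjoin_map, IntermediateField.adjoin_le_iff]
    rintro _ ⟨_, rfl, rfl⟩
    exact hτL τ
  have hgal : IsGalois k L := ⟨⟩
  refine ⟨hgal, ?_⟩
  have hfixK (τ : Gal(F/K)) (a : F) (ha : a ∈ K) : τ.restrictScalars k a = a :=
    τ.commutes ⟨a, ha⟩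
  -- Automorphisms over K send x to ±x and so fix x².
  have hsq : x ^ 2 ∈ K := by
    have : x ^ 2 ∈ Set.range (algebraMap K F) := by
      rw [InfiniteGalois.mem_range_algebraMap_iff_fixed]
      intro τ
      rw [map_pow]
      rcases hpm _ (hfixK τ) with h | h
      · rw [show τ x = x from h]
      · rw [show τ x = -x from h, neg_sq]
    obtain ⟨a, ha⟩ := this
    rw [← ha]
    exact a.2
  have hint : IsIntegral K x := Algebra.IsIntegral.isIntegral x
  have hdeg : (minpoly K x).natDegree = 2 := by
    apply le_antisymm
    · have hm : (Polynomial.X ^ 2 - Polynomial.C (⟨x ^ 2, hsq⟩ : K)).Monic :=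
        Polynomial.monic_X_pow_sub_C _ two_ne_zero
      have := Polynomial.natDegree_le_of_dvd (minpoly.dvd K x
        (p := Polynomial.X ^ 2 - Polynomial.C (⟨x ^ 2, hsq⟩ : K)) (by simp)) hm.ne_zero
      rwa [Polynomial.natDegree_X_pow_sub_C] at this
    · rw [minpoly.two_le_natDegree_iff hint]
      rintro ⟨a, ha⟩
      exact hx (ha ▸ a.2)
  have hLr : L = (IntermediateField.adjoin K {x}).restrictScalars k := by
    rw [hL, ← IntermediateField.restrictScalars_adjoin_eq_sup]
  have hrank : Module.finrank k L = 4 := by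
    have : Module.finrank k (IntermediateField.adjoin K {x}) = 4 := by
      rw [← Module.finrank_mul_finrank k K, hK, IntermediateField.adjoin.finrank hint, hdeg]
    rw [hLr]
    exact this
  have : FiniteDimensional k L := Module.finite_of_finrank_pos (by omega)
  have hcard : Nat.card Gal(L/k) = 4 := by rw [IsGalois.card_aut_eq_finrank, hrank]
  -- It suffices to check the generators of L: on K the restriction has order dividing 2, and on x
  -- both hypotheses give τ(τ(x)) = x.
  have hττ (τ : Gal(F/k)) (y : F) (hy : y ∈ L) : τ (τ y) = y := by
    have hres : τ.restrictNormal K * τ.restrictNormal K = 1 := by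
      have : Nat.card Gal(K/k) = 2 := by
        rw [IsGalois.card_aut_eq_finrank, hK]
      rw [← pow_two, ← this, pow_card_eq_one']
    have hτx : τ (τ x) = x := by
      by_cases hτ : ∀ a ∈ K, τ a = a
      · rcases hpm τ hτ with h | h <;> simp [h]
      · obtain ⟨r, hr⟩ := h₂ τ hτ
        have h3 := congrArg τ hr
        rw [map_mul, AlgEquiv.commutes, ← hr, mul_comm x] at h3
        exact mul_left_cancel₀ (by simpa using hx0) h3
    have hLa : L = IntermediateField.adjoin k ((K : Set F) ∪ {x}) := by
      rw [hL, IntermediateField.adjoin_union, IntermediateField.adjoin_self]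
    rw [hLa] at hy
    induction hy using IntermediateField.adjoin_induction with
    | mem z hz =>
      rcases hz with hz | hz
      · have h1 := AlgEquiv.restrictNormal_commutes τ K ⟨z, hz⟩
        have h2 := AlgEquiv.restrictNormal_commutes τ K (τ.restrictNormal K ⟨z, hz⟩)
        rw [h1] at h2
        have h3 := congrArg (fun g : Gal(K/k) => algebraMap K F (g ⟨z, hz⟩)) hres
        exact h2.symm.trans h3
      · rw [Set.mem_singleton_iff.mp hz]
        exact hτx
    | algebraMap r => simp
    | add a b _ _ ha hb => rw [map_add, map_add, ha, hb]
    | inv a _ ha => rw [map_inv₀, map_inv₀, ha]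
    | mul a b _ _ ha hb => rw [map_mul, map_mul, ha, hb]
  exact isKleinFour_of_card_of_sq hcard (by
    intro g
    obtain ⟨τ, rfl⟩ := AlgEquiv.restrictNormalHom_surjective (F := k) (K₁ := L) F g
    ext a
    rw [← map_mul]
    have := AlgEquiv.restrictNormal_commutes (τ * τ) L a
    exact this.trans (hττ τ a a.2))

end Klein

/-- Only reconciles `ℚ`-algebra structures on `Qbar`: any two are equal. -/
instance isGalois_Qbar : IsGalois ℚ Qbar := by
  have h : @IsGalois ℚ _ Qbar _ (AlgebraicClosure.instAlgebra ℚ) := inferInstance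
  convert h
  exact Subsingleton.elim _ _

theorem normal_of_finrank_eq_two {K : IntermediateField ℚ Qbar} (hK : Module.finrank ℚ K = 2) :
    Normal ℚ K := by
  have h : @Algebra.IsQuadraticExtension ℚ K _ _ _ K.algebra' := ⟨hK⟩
  have h' : @Normal ℚ K _ _ K.algebra' := inferInstance
  convert h'
  exact Subsingleton.elim _ _

/-! ### Factors of isogenies between conjugates of a `ℚ`-curve -/

section Curves

variable {K : IntermediateField ℚ Qbar}

instance infinite_geom (E : WeierstrassCurve K) [E.IsElliptic] :
    Infinite (geom E).toAffine.Point := by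
  have : (geom E).IsElliptic := inferInstanceAs (E.map (algebraMap K Qbar)).IsElliptic
  exact infinite_point

instance isElliptic_conj (E : WeierstrassCurve K) [E.IsElliptic] (σ : Gal(K/ℚ)) :
    (conj σ E).IsElliptic := inferInstanceAs (E.map (σ : K →+* K)).IsElliptic

theorem conj_one (E : WeierstrassCurve K) : conj 1 E = E := rfl

theorem Isogeny.conj_apply_of_zsmul {F : Type*} [Field F] [DecidableEq F] [CharZero F]
    {W W' : WeierstrassCurve F} [Infinite W.toAffine.Point] {φ : Isogeny W W} {n : ℤ}
    (hφ : ∀ P, φ.toHom P = n • P) (τ : F ≃+* F) (h h' : W' = W.map (τ : F →+* F))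
    (P : W'.toAffine.Point) : (φ.conj τ h h').toHom P = n • P := by
  obtain ⟨P, rfl⟩ := (pointConj τ h).surjective P
  refine (homConj_pointConj h h' φ.toHom P).trans ?_
  rw [hφ, map_zsmul]

variable [Normal ℚ K]

theorem geom_conj_mul (E : WeierstrassCurve K) (τ : Gal(Qbar/ℚ)) (ρ : Gal(K/ℚ)) :
    geom (conj (τ.restrictNormal K * ρ) E) =
      (geom (conj ρ E)).map ((τ : Qbar ≃+* Qbar) : Qbar →+* Qbar) := by
  have h (a : K) := AlgEquiv.restrictNormal_commutes τ K (ρ a)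
  simp only [geom, conj, WeierstrassCurve.baseChange, WeierstrassCurve.map_map]
  congr 1
  ext a
  exact h a

theorem geom_conj_restrictNormal (E : WeierstrassCurve K) (τ : Gal(Qbar/ℚ)) :
    geom (conj (τ.restrictNormal K) E) =
      (geom E).map ((τ : Qbar ≃+* Qbar) : Qbar →+* Qbar) := by
  have := geom_conj_mul E τ 1
  rwa [mul_one, conj_one] at this

theorem geom_eq_map (E : WeierstrassCurve K) (τ : Gal(Qbar/ℚ)) {ρ : Gal(K/ℚ)}
    (h : τ.restrictNormal K * ρ = 1) :
    geom E = (geom (conj ρ E)).map ((τ : Qbar ≃+* Qbar) : Qbar →+* Qbar) := by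
  rw [← geom_conj_mul E τ ρ, h, conj_one]

variable {E : WeierstrassCurve K} [E.IsElliptic]

/-- The factor of an endomorphism of a `ℚ`-curve without complex multiplication is rational. -/
theorem exists_rat_of_endomorphism (hE : IsQCurve E) (hCM : ¬ HasCM (geom E))
    {φ : Isogeny (geom E) (geom E)} {l : Qbar} (hl : φ.HasFactor l) :
    ∃ r : ℚ, algebraMap ℚ Qbar r = l := by
  unfold HasCM at hCM
  push Not at hCM
  obtain ⟨n, hn⟩ := hCM φ
  change l ∈ Set.range (algebraMap ℚ Qbar)
  rw [InfiniteGalois.mem_range_algebraMap_iff_fixed]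
  intro τ
  obtain ⟨ν⟩ := hE (τ.restrictNormal K)
  obtain ⟨m, hm⟩ := ν.exists_hasFactor
  have h := geom_conj_restrictNormal E τ
  have h1 := hm.comp (hl.conj h h)
  have h2 := hl.comp hm
  -- Both φ and its conjugate are multiplication by n, so ν intertwines them; comparing factors
  -- gives m·τ(l) = l·m.
  have heq := h1.unique_of_toHom_eq h2 (by
    ext P
    change ν.toHom ((φ.conj (τ : Qbar ≃+* Qbar) h h).toHom P) = φ.toHom (ν.toHom P)
    rw [Isogeny.conj_apply_of_zsmul hn, hn, map_zsmul])
  rw [mul_comm l] at heq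
  exact mul_left_cancel₀ hm.1 heq

/-- As ρ is inverse to τ on K, the τ-conjugate of ψ runs from E to the conjugate of E by τ.
Following it with φ gives an endomorphism of E with factor m·τ(l). -/
theorem exists_rat_mul (hE : IsQCurve E) (hCM : ¬ HasCM (geom E)) (τ : Gal(Qbar/ℚ)) {ρ : Gal(K/ℚ)}
    (hρ : τ.restrictNormal K * ρ = 1)
    {φ : Isogeny (geom (conj (τ.restrictNormal K) E)) (geom E)} {m : Qbar} (hm : φ.HasFactor m)
    {ψ : Isogeny (geom (conj ρ E)) (geom E)} {l : Qbar} (hl : ψ.HasFactor l) :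
    ∃ r : ℚ, algebraMap ℚ Qbar r = m * τ l :=
  exists_rat_of_endomorphism hE hCM
    (hm.comp (hl.conj (geom_eq_map E τ hρ) (geom_conj_restrictNormal E τ)))

theorem exists_rat_mul_of_restrictNormal_eq_one (hE : IsQCurve E) (hCM : ¬ HasCM (geom E))
    (τ : Gal(Qbar/ℚ)) (hτ : τ.restrictNormal K = 1) {ρ : Gal(K/ℚ)}
    {φ : Isogeny (geom (conj ρ E)) (geom E)} {l : Qbar} (hl : φ.HasFactor l) :
    ∃ r : ℚ, τ l = algebraMap ℚ Qbar r * l := by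
  obtain ⟨σ, rfl⟩ := AlgEquiv.restrictNormalHom_surjective (F := ℚ) (K₁ := K) Qbar ρ
  -- The σ-conjugate of ψ runs from E to the common source of φ and its τ-conjugate, closing both up
  -- to endomorphisms of E. So l·σ(m) and τ(l)·σ(m) are rational, and so is their quotient.
  obtain ⟨ψ⟩ := hE (σ.restrictNormal K)⁻¹
  obtain ⟨m, hm⟩ := ψ.exists_hasFactor
  have h₁ : geom (conj (σ.restrictNormal K) E) =
      (geom (conj (σ.restrictNormal K) E)).map ((τ : Qbar ≃+* Qbar) : Qbar →+* Qbar) := by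
    rw [← geom_conj_mul, hτ, one_mul]
  have h₂ : geom E = (geom E).map ((τ : Qbar ≃+* Qbar) : Qbar →+* Qbar) := by
    rw [← geom_conj_restrictNormal, hτ, conj_one]
  obtain ⟨r, hr⟩ := exists_rat_mul hE hCM σ (mul_inv_cancel _) hl hm
  obtain ⟨s, hs⟩ := exists_rat_mul hE hCM σ (mul_inv_cancel _) (hl.conj h₁ h₂) hm
  have hσm : σ m ≠ 0 := by simpa using hm.1
  refine ⟨s / r, ?_⟩
  rw [map_div₀, hr, hs]
  have := hl.1
  change τ l = τ l * σ m / (l * σ m) * l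
  field_simp

/-- If all factors lie in `K`, then the `ℚ`-curve is completely defined over `K`. -/
theorem isCompletelyDefined_of_factor_mem (hE : IsQCurve E) (hCM : ¬ HasCM (geom E))
    (μ : ∀ σ : Gal(K/ℚ), Isogeny (geom (conj σ E)) (geom E))
    (h : ∀ σ l, (μ σ).HasFactor l → l ∈ K) : IsCompletelyDefined E := by
  refine ⟨hE, fun ρ π φ => ?_⟩
  obtain ⟨σ, rfl⟩ := AlgEquiv.restrictNormalHom_surjective (F := ℚ) (K₁ := K) Qbar ρ
  obtain ⟨l, hl⟩ := φ.exists_hasFactor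
  obtain ⟨m, hm⟩ := (μ π).exists_hasFactor
  obtain ⟨m', hm'⟩ := (μ (σ.restrictNormal K)⁻¹).exists_hasFactor
  -- Closing φ up to an endomorphism of E on both sides makes m·l·σ(m') rational, and m and σ(m')
  -- lie in K.
  have hlK : l ∈ K := by
    obtain ⟨r, hr⟩ := exists_rat_mul hE hCM σ (mul_inv_cancel _) (hm.comp hl) hm'
    have hσm : σ m' ∈ K := by
      have := AlgEquiv.restrictNormal_commutes σ K ⟨m', h _ _ hm'⟩
      rw [show σ m' = _ from this.symm]
      exact (σ.restrictNormal K ⟨m', h _ _ hm'⟩).2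
    have hσm0 : σ m' ≠ 0 := by simpa using hm'.1
    have hm0 := hm.1
    have : l = algebraMap ℚ Qbar r / (m * σ m') := by
      rw [hr]
      field_simp
    rw [this]
    exact K.div_mem (K.algebraMap_mem r) (K.mul_mem (h _ _ hm) hσm)
  have : Infinite ((conj (σ.restrictNormal K) E).map (algebraMap K Qbar)).toAffine.Point :=
    infinite_geom (conj (σ.restrictNormal K) E)
  refine Isogeny.isDefinedOver_of_conj_eq (k := K) (F := Qbar)
    (W₁ := conj (σ.restrictNormal K) E) (W₂ := conj π E) ?_ φ ?_
  · intro x hx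
    exact (InfiniteGalois.mem_range_algebraMap_iff_fixed (k := K) x).mpr hx
  · intro τ h₁ h₂
    have hc := hl.conj (τ := (τ : Qbar ≃+* Qbar)) h₁ h₂
    -- Since l ∈ K, the conjugate of φ over K has the same factor, hence equals φ, and descent
    -- applies.
    rw [show (τ : Qbar ≃+* Qbar) l = l from τ.commutes ⟨l, hlK⟩] at hc
    exact hc.toHom_eq hl

end Curves

end QCurve

/-! ### The main theorem -/

theorem mainTheorem8 (K : IntermediateField ℚ QCurve.Qbar) (hK : Module.finrank ℚ K = 2)
    (E : WeierstrassCurve K) [E.IsElliptic]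
    (hE : QCurve.IsQCurve E) (hCM : ¬ QCurve.HasCM (QCurve.geom E))
    (hnot : ¬ QCurve.IsCompletelyDefined E)
    (μ : ∀ σ : Gal(K/ℚ), QCurve.Isogeny (QCurve.geom (QCurve.conj σ E)) (QCurve.geom E)) :
    IsGalois ℚ (QCurve.minimalField E μ) ∧
      Nonempty (Gal(QCurve.minimalField E μ/ℚ) ≃*
        Multiplicative (ZMod 2) × Multiplicative (ZMod 2)) := by
  open QCurve in
  have hnormal : Normal ℚ K := normal_of_finrank_eq_two hK
  have hgal : IsGalois ℚ K := ⟨⟩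
  have hcard : Nat.card Gal(K/ℚ) = 2 := by
    have : FiniteDimensional ℚ K := Module.finite_of_finrank_pos (by
      convert Nat.two_pos)
    rw [IsGalois.card_aut_eq_finrank]
    convert hK
  have hrat {l : Qbar} (hl : (μ 1).HasFactor l) : ∃ r : ℚ, algebraMap ℚ Qbar r = l :=
    exists_rat_of_endomorphism hE hCM (φ := μ 1) hl
  obtain ⟨σ, x, hx, hxK⟩ : ∃ σ x, (μ σ).HasFactor x ∧ x ∉ K := by
    by_contra! h
    exact hnot (isCompletelyDefined_of_factor_mem hE hCM μ h)
  have hσ : σ ≠ 1 := by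
    rintro rfl
    obtain ⟨r, rfl⟩ := hrat hx
    exact hxK (K.algebraMap_mem r)
  have hcases (ρ : Gal(K/ℚ)) (hρ : ρ ≠ 1) : ρ = σ := by
    obtain ⟨π, -, hπ⟩ := (Nat.card_eq_two_iff' (1 : Gal(K/ℚ))).mp hcard
    rw [hπ ρ hρ, hπ σ hσ]
  have hσσ : σ * σ = 1 := by rw [← pow_two, ← hcard, pow_card_eq_one']
  -- The factor of μ₁ is rational and contributes nothing, so only the factor x of μ_σ generates L
  -- over K.
  have hL : minimalField E μ = K ⊔ IntermediateField.adjoin ℚ {x} := by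
    refine le_antisymm (sup_le le_sup_left ?_) (sup_le_sup_left ?_ _)
    · rw [IntermediateField.adjoin_le_iff]
      rintro l ⟨ρ, hl⟩
      by_cases hρ : ρ = 1
      · subst hρ
        obtain ⟨r, rfl⟩ := hrat hl
        exact IntermediateField.algebraMap_mem _ r
      · obtain rfl := hcases ρ hρ
        rw [hl.unique_of_toHom_eq hx rfl]
        exact (le_sup_right : _ ≤ K ⊔ IntermediateField.adjoin ℚ {x})
          (IntermediateField.mem_adjoin_simple_self ℚ x)
    · apply IntermediateField.adjoin.mono
      rintro _ rfl
      exact ⟨σ, hx⟩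
  have hres (τ : Gal(Qbar/ℚ)) : τ.restrictNormal K = 1 ↔ ∀ a ∈ K, τ a = a := by
    constructor
    · intro h a ha
      have := AlgEquiv.restrictNormal_commutes τ K ⟨a, ha⟩
      rw [h] at this
      exact this.symm
    · intro h
      ext a
      exact (AlgEquiv.restrictNormal_commutes τ K a).trans (h a a.2)
  obtain ⟨h1, h2⟩ := isGalois_and_isKleinFour hK hxK
    (fun τ hτ => exists_rat_mul_of_restrictNormal_eq_one hE hCM τ ((hres τ).mpr hτ) hx)
    (fun τ hτ => by
      obtain rfl := hcases _ (mt (hres τ).mp hτ)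
      -- Here τ restricts to σ, which is its own inverse, so μ_σ can be composed with its own
      -- τ-conjugate.
      obtain ⟨r, hr⟩ := exists_rat_mul hE hCM τ hσσ hx hx
      exact ⟨r, hr.symm⟩) hL
  -- Identifies the `ℚ`-algebra structure of L as an intermediate field with the one that every
  -- characteristic-zero division ring carries.
  have halg : (minimalField E μ).algebra' = DivisionRing.toRatAlgebra := Subsingleton.elim _ _
  rw [halg] at h1 h2
  exact ⟨h1, IsKleinFour.nonempty_mulEquiv⟩
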